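/- Let $q\in\mathbb C^*$ not be a root of unity, let $n=2s\ge 0$ be an integer, and let $b,c,b^*,c^*,\zeta,\chi\in\mathbb C^*$ with $bc=b^*c^*$. Assume genericity in the form $c\ne b\,q^{2k}$ and $c^*\ne b^*q^{2k}$ for all integers $-1\le k\le 2n+1$. Put $\mathsf b(x)=x-x^{-1}$, $[X,Y]_r=rXY-r^{-1}YX$, $(a;Q)_k=\prod_{j=0}^{k-1}(1-aQ^j)$, and $$\theta_M=bq^{2M}+cq^{-2M},\quad \theta^*_N=b^*q^{2N}+c^*q^{-2N},\quad \tau=bq^{n}+cq^{-n},\quad \tau^*=b^*q^{n}+c^*q^{-n},\quad Z=\zeta^2+\zeta^{-2},\quad \sigma=q^{n+1}+q^{-n-1},$$ $$\rho=-bc(q^2-q^{-2})^2,\quad \omega=(q-q^{-1})^2\bigl(bcZ\sigma-\tau\tau^*\bigr),\quad \eta=-\tfrac{(q^2-q^{-2})^2}{q+q^{-1}}bc\,(\tau Z-\tau^*\sigma),\quad \eta^*=-\tfrac{(q^2-q^{-2})^2}{q+q^{-1}}b^*c^*(\tau^*Z-\tau\sigma).$$ **Leonard pair.** Let $V$ be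 a complex vector space of dimension $n+1$ and let $A,A^*\in\mathrm{End}(V)$ be the images of the generators in an irreducible representation of the Askey–Wilson algebra $$[A,[A,A^*]_q]_{q^{-1}}=\rho A^*+\omega A+\eta,\qquad [A^*,[A^*,A]_q]_{q^{-1}}=\rho A+\omega A^*+\eta^*,$$ such that $A$ is diagonalizable with distinct eigenvalues $\theta_0,\dots,\theta_n$ and $A^*$ is diagonalizable with distinct eigenvalues $\theta^*_0,\dots,\theta^*_n$. Choose nonzero vectors $|\Omega^-\rangle,|\Omega^+\rangle\in V$ and a nonzero linear functional $\langle\Omega^+|$ on $V$ with $A|\Omega^-\rangle=\theta_0|\Omega^-\rangle$, $A^*|\Omega^+\rangle=\theta_0^*|\Omega^+\rangle$, $\langle\Omega^+|A^*=\theta^*_0\langle\Omega^+|$; $\langle\cdot|\cdot\rangle$ denotes the pairing of functionals and vectors. **Dynamical operators.** With $\bar\eta(u)=(q+q^{-1})\rho^{-1}(\eta u+\eta^*u^{-1})$ let $$K_{11}(u)=\mathsf b(u^2)(quA-q^{-1}u^{-1}A^*)-\bar\eta(u),\qquad K_{22}(u)=\mathsf b(u^2)(quA^*-q^{-1}u^{-1}A)-\bar\eta(u^{-1}),$$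 $$K_{12}(u)=\chi\,\mathsf b(u^2)\Bigl(\rho^{-1}\bigl([A^*,A]_q+\tfrac{\omega}{q-q^{-1}}\bigr)+\tfrac{qu^2+q^{-1}u^{-2}}{q^2-q^{-2}}\Bigr),\quad K_{21}(u)=\rho\chi^{-1}\mathsf b(u^2)\Bigl(\rho^{-1}\bigl([A,A^*]_q+\tfrac{\omega}{q-q^{-1}}\bigr)+\tfrac{qu^2+q^{-1}u^{-2}}{q^2-q^{-2}}\Bigr).$$ For $\epsilon=\pm1$, $m\in\mathbb Z$, $\alpha,\beta\in\mathbb C$ let $\gamma^\epsilon(u,m)=\alpha^{\frac{1-\epsilon}2}\beta^{\frac{1+\epsilon}2}q^{-m}u-\alpha^{\frac{1+\epsilon}2}\beta^{\frac{1-\epsilon}2}q^{m}u^{-1}$, and with $y=\beta q^{-\epsilon m}$, $x=\alpha q^{\epsilon m}$, $$\mathscr B^\epsilon(u,m)=\tfrac{-\epsilon(qu)^{-\epsilon}}{\gamma^\epsilon(1,m+1)}\bigl(K_{12}+yu^{-\epsilon}K_{11}-yu^{\epsilon}K_{22}-y^2K_{21}\bigr)(u),\quad \mathscr C^\epsilon(u,m)=\tfrac{\epsilon(qu)^{-\epsilon}}{\gamma^\epsilon(1,m-1)}\bigl(K_{12}+xu^{-\epsilon}K_{11}-xu^{\epsilon}K_{22}-x^2K_{21}\bigr)(u).$$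 **Bethe states.** Fix $m_0\in\mathbb Z$. For $\bar u=(u_1,\dots,u_M)$ and $\bar v=(v_1,\dots,v_N)$ put $$|\Psi_-^M(\bar u)\rangle=\mathscr B^-(u_1,m_0+2(M-1))\cdots\mathscr B^-(u_M,m_0)|\Omega^-\rangle,\quad \beta=0,\ (q^2-q^{-2})\chi^{-1}\alpha bq^{-m_0}=-1,$$ $$|\Psi_+^N(\bar v)\rangle=\mathscr B^+(v_1,m_0+2(N-1))\cdots\mathscr B^+(v_N,m_0)|\Omega^+\rangle,\quad \beta=0,\ (q^2-q^{-2})\chi^{-1}\alpha c^*q^{m_0}=1,$$ $$\langle\Psi_+^N(\bar v)|=\langle\Omega^+|\mathscr C^+(v_1,m_0+2)\cdots\mathscr C^+(v_N,m_0+2N),\quad \alpha=0,\ (q^2-q^{-2})\chi^{-1}\beta b^*q^{-m_0+2}=1.$$ **Bethe equations.** Let $f(u,v)=\frac{\mathsf b(qv/u)\mathsf b(uv)}{\mathsf b(v/u)\mathsf b(quv)}$, $h(u,v)=\frac{\mathsf b(q^2uv)\mathsf b(qu/v)}{\mathsf b(quv)\mathsf b(u/v)}$, and for $\epsilon=\pm1$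 $$\Lambda_1^\epsilon(u)=\tfrac{q^{-n-1}}{u^\epsilon}(q^{n+1}u\zeta^{-1}-u^{-1}\zeta)(q^{n+1}u\zeta-u^{-1}\zeta^{-1})(uc^*q^{-n}+u^{-1}bq^n)\Bigl(u(\tfrac c{c^*})^{\frac{1-\epsilon}2}+u^{-1}(\tfrac{b^*}b)^{\frac{1+\epsilon}2}\Bigr),$$ $$\Lambda_2^\epsilon(u)=\tfrac{(u^2-u^{-2})q^{-n-1}}{u^\epsilon(qu^2-q^{-1}u^{-2})}(q^{n-1}u^{-1}\zeta-u\zeta^{-1})(q^{n-1}u^{-1}\zeta^{-1}-u\zeta)(q^{2}ubq^{n}+u^{-1}c^*q^{-n})\Bigl(q^2u(\tfrac{b^*}b)^{\frac{1+\epsilon}2}+u^{-1}(\tfrac c{c^*})^{\frac{1-\epsilon}2}\Bigr),$$ $$E_\epsilon^M(u_i,\bar u_i)=-\frac{\mathsf b(u_i^2)}{\mathsf b(qu_i^2)}\prod_{j\ne i}f(u_i,u_j)\,\Lambda_1^\epsilon(u_i)+\prod_{j\ne i}h(u_i,u_j)\,\Lambda_2^\epsilon(u_i).$$ A non-trivial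 admissible solution of the homogeneous Bethe equations $E^M_\epsilon=0$ is a tuple $\bar u$ with $u_i\ne0$, $u_i^2\ne u_i^{-2}$, $\mathsf b(qu_i^2)\neq 0$ for all $i$, with $U_i\neq U_j$ for $i\neq j$, where $U_i=(qu_i^2+q^{-1}u_i^{-2})/(q+q^{-1})$, and with $E_\epsilon^M(u_i,\bar u_i)=0$ for $i=1,\dots,M$. **Statement.** Let $0\le M,N\le n$, let $\bar u=(u_1,\dots,u_M)$ be any non-trivial admissible solution of $E_-^M=0$ and $\bar v=(v_1,\dots,v_N)$ any non-trivial admissible solution of $E_+^N=0$. Put $$R_M(\theta_N^*)={}_4\phi_3\!\left(\begin{matrix}q^{-2M},\ \frac bc q^{2M},\ q^{-2N},\ \frac{b^*}{c^*}q^{2N}\\ -\frac b{c^*}q^{n+1}\zeta^2,\ -\frac{b^*}{c}q^{n+1}\zeta^{-2},\ q^{-2n}\end{matrix};q^2,q^2\right),\qquad \mathcal N_N^*(\bar v)=\prod_{k=1}^N\bigl(-q^{-1}v_k^{-1}\mathsf b(v_k^2)A_{k,k-1}\bigr)^{-1},$$ $$A_{k,k-1}=q^{2-2n}\,\frac{(1-q^{2k})(c^*-b^*q^{2k+2n})(bq^{n-1}\zeta^{2}+b^*q^{2k-2})(c^*q^{n-1}\zeta^{-2}+cq^{2k-2})}{(c^*-b^*q^{4k-2})(c^*-b^*q^{4k})}.$$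 Then $(-\frac b{c^*}q^{n+1}\zeta^2;q^2)_k$, $(-\frac{b^*}cq^{n+1}\zeta^{-2};q^2)_k$, $(q^{-2n};q^2)_k$ $(0\le k\le n)$, all the factors of $\mathcal N_N^*(\bar v)^{-1}$, $\langle\Omega^+|\Psi_-^M(\bar u)\rangle$ and $\langle\Psi_+^N(\bar v)|\Psi_+^N(\bar v)\rangle$ are nonzero, and $$R_M(\theta_N^*)=\mathcal N_N^*(\bar v)^{-1}\,\frac{\langle\Psi_+^N(\bar v)|\Psi_-^M(\bar u)\rangle}{\langle\Omega^+|\Psi_-^M(\bar u)\rangle}\,\frac{\langle\Omega^+|\Omega^+\rangle}{\langle\Psi_+^N(\bar v)|\Psi_+^N(\bar v)\rangle}.$$ (If such solutions exist for all $0\le M,N\le n$, this expresses all the $q$-Racah polynomials through on-shell Bethe states.) -/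

import Mathlib

/-!
 Bethe states of a Leonard pair of q-Racah type and the q-Racah polynomials.
 All scalars are complex numbers; `n` stands for `2 s`, so the modules have dimension `n + 1`.
-/

noncomputable section

namespace BetheRacah

/-! ### Scalar parameters -/

/-- The scalar parameters: `q`, the numbers `b, c, b*, c*` of the two eigenvalue sequences, the
parameter `ζ` of the structure constants, the scalar `χ` of the reflection algebra presentation,
and the integer `n = 2 s`. -/
structure Params where
  q : ℂ
  b : ℂ
  c : ℂ
  bs : ℂ
  cs : ℂ
  ζ : ℂ
  χ : ℂ
  n : ℕ

/-- The function `b(x) = x - x⁻¹`. -/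
def bf (x : ℂ) : ℂ := x - x⁻¹

/-- The `q`-shifted factorial `(a; Q)_k`. -/
def qPoch (a Q : ℂ) (k : ℕ) : ℂ := ∏ j ∈ Finset.range k, (1 - a * Q ^ j)

/-- The basic hypergeometric series `₄φ₃(a₁, a₂, a₃, a₄; d₁, d₂, d₃; Q, z)`. In a terminating series
all terms with a vanishing numerator are zero. -/
def fourPhiThree (a₁ a₂ a₃ a₄ d₁ d₂ d₃ Q z : ℂ) : ℂ :=
  ∑' k : ℕ, qPoch a₁ Q k * qPoch a₂ Q k * qPoch a₃ Q k * qPoch a₄ Q k /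
    (qPoch d₁ Q k * qPoch d₂ Q k * qPoch d₃ Q k * qPoch Q Q k) * z ^ k

namespace Params

/-- Standing assumptions on the parameters: `q ≠ 0` is not a root of unity, the scalars are nonzero,
`b c = b* c*`, and the finitely many non-coincidences `c / b ≠ q^{2k}`, `c* / b* ≠ q^{2k}`
(`-1 ≤ k ≤ 2 n + 1`) that genericity provides. -/
structure Valid (p : Params) : Prop where
  q_ne : p.q ≠ 0
  q_not_root : ∀ k : ℕ, 0 < k → p.q ^ k ≠ 1
  b_ne : p.b ≠ 0
  c_ne : p.c ≠ 0
  bs_ne : p.bs ≠ 0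
  cs_ne : p.cs ≠ 0
  ζ_ne : p.ζ ≠ 0
  χ_ne : p.χ ≠ 0
  bc_eq : p.b * p.c = p.bs * p.cs
  generic : ∀ k : ℤ, -1 ≤ k → k ≤ 2 * p.n + 1 → p.c ≠ p.b * p.q ^ (2 * k)
  generic_star : ∀ k : ℤ, -1 ≤ k → k ≤ 2 * p.n + 1 → p.cs ≠ p.bs * p.q ^ (2 * k)

/-- The exchange `(b, c, ζ) ↔ (b*, c*, ζ⁻¹)`. -/
def swap (p : Params) : Params where
  q := p.q
  b := p.bs
  c := p.cs
  bs := p.b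
  cs := p.c
  ζ := p.ζ⁻¹
  χ := p.χ
  n := p.n

/-- `θ_M = b q^{2M} + c q^{-2M}`. -/
def θ (p : Params) (M : ℕ) : ℂ := p.b * p.q ^ (2 * (M : ℤ)) + p.c * p.q ^ (-2 * (M : ℤ))

/-- `θ*_N = b* q^{2N} + c* q^{-2N}`. -/
def θs (p : Params) (N : ℕ) : ℂ := p.bs * p.q ^ (2 * (N : ℤ)) + p.cs * p.q ^ (-2 * (N : ℤ))

/-- The structure constant `ρ` (with `b c = b* c*`). -/
def ρ (p : Params) : ℂ := -(p.b * p.c) * (p.q ^ 2 - p.q ^ (-2 : ℤ)) ^ 2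

/-- The structure constant `ω`. -/
def ω (p : Params) : ℂ :=
  (p.q - p.q⁻¹) ^ 2 *
    (p.b * p.c * (p.ζ ^ 2 + p.ζ ^ (-2 : ℤ)) * (p.q ^ (p.n + 1) + p.q ^ (-(p.n : ℤ) - 1))
      - (p.b * p.q ^ p.n + p.c * p.q ^ (-(p.n : ℤ)))
        * (p.bs * p.q ^ p.n + p.cs * p.q ^ (-(p.n : ℤ))))

/-- The structure constant `η`. -/
def η (p : Params) : ℂ :=
  -((p.q ^ 2 - p.q ^ (-2 : ℤ)) ^ 2 / (p.q + p.q⁻¹)) * (p.b * p.c) *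
    ((p.b * p.q ^ p.n + p.c * p.q ^ (-(p.n : ℤ))) * (p.ζ ^ 2 + p.ζ ^ (-2 : ℤ))
      - (p.bs * p.q ^ p.n + p.cs * p.q ^ (-(p.n : ℤ)))
        * (p.q ^ (p.n + 1) + p.q ^ (-(p.n : ℤ) - 1)))

/-- The structure constant `η*`. -/
def ηs (p : Params) : ℂ :=
  -((p.q ^ 2 - p.q ^ (-2 : ℤ)) ^ 2 / (p.q + p.q⁻¹)) * (p.bs * p.cs) *
    ((p.bs * p.q ^ p.n + p.cs * p.q ^ (-(p.n : ℤ))) * (p.ζ ^ 2 + p.ζ ^ (-2 : ℤ))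
      - (p.b * p.q ^ p.n + p.c * p.q ^ (-(p.n : ℤ)))
        * (p.q ^ (p.n + 1) + p.q ^ (-(p.n : ℤ) - 1)))

/-- The coefficient `A*_{M,M-1}` of the action of `A*` on the eigenbasis of `A`, for `M ≥ 1`. -/
def AsSub (p : Params) (M : ℕ) : ℂ :=
  p.q ^ (2 - 2 * (p.n : ℤ)) *
    ((1 - p.q ^ (2 * M)) * (p.c - p.b * p.q ^ (2 * M + 2 * p.n))
      * (p.bs * p.q ^ ((p.n : ℤ) - 1) * p.ζ ^ (-2 : ℤ) + p.b * p.q ^ (2 * (M : ℤ) - 2))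
      * (p.c * p.q ^ ((p.n : ℤ) - 1) * p.ζ ^ 2 + p.cs * p.q ^ (2 * (M : ℤ) - 2)))
    / ((p.c - p.b * p.q ^ (4 * (M : ℤ) - 2)) * (p.c - p.b * p.q ^ (4 * (M : ℤ))))

/-- The coefficient `A_{N,N-1}` of the action of `A` on the eigenbasis of `A*`, for `N ≥ 1`. -/
def ASub (p : Params) (N : ℕ) : ℂ := p.swap.AsSub N

/-- The `q`-Racah polynomial `R_M(θ*_N)`. -/
def qRacah (p : Params) (M N : ℕ) : ℂ :=
  fourPhiThree
    (p.q ^ (-2 * (M : ℤ))) (p.b / p.c * p.q ^ (2 * M))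
    (p.q ^ (-2 * (N : ℤ))) (p.bs / p.cs * p.q ^ (2 * N))
    (-(p.b / p.cs) * p.q ^ (p.n + 1) * p.ζ ^ 2)
    (-(p.bs / p.c) * p.q ^ (p.n + 1) * p.ζ ^ (-2 : ℤ))
    (p.q ^ (-2 * (p.n : ℤ)))
    (p.q ^ 2) (p.q ^ 2)

end Params

/-! ### Representations of the Askey-Wilson algebra -/

section Operators

variable {V : Type*} [AddCommGroup V] [Module ℂ V]

/-- `[X, Y]_r = r X Y - r⁻¹ Y X`. -/
def qComm (r : ℂ) (X Y : Module.End ℂ V) : Module.End ℂ V := r • (X * Y) - r⁻¹ • (Y * X)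

/-- `A, As` are the images of the two generators in an irreducible representation of dimension
`n + 1` of the Askey-Wilson algebra with the structure constants `ρ, ω, η, η*`, on which `A` and `As`
are diagonalizable and multiplicity-free with eigenvalue sequences `θ_0, …, θ_n` and
`θ*_0, …, θ*_n` (`n + 1` distinct eigenvalues in dimension `n + 1`). -/
structure IsAWPair (p : Params) (A As : Module.End ℂ V) : Prop where
  finrank_eq : Module.finrank ℂ V = p.n + 1
  aw₁ : qComm p.q⁻¹ A (qComm p.q A As) = p.ρ • As + p.ω • A + p.η • 1
  aw₂ : qComm p.q⁻¹ As (qComm p.q As A) = p.ρ • A + p.ω • As + p.ηs • 1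
  irreducible : ∀ W : Submodule ℂ V, (∀ x ∈ W, A x ∈ W) → (∀ x ∈ W, As x ∈ W) → W = ⊥ ∨ W = ⊤
  θ_inj : ∀ M ≤ p.n, ∀ M' ≤ p.n, p.θ M = p.θ M' → M = M'
  θ_eig : ∀ M ≤ p.n, Module.End.HasEigenvalue A (p.θ M)
  θs_inj : ∀ N ≤ p.n, ∀ N' ≤ p.n, p.θs N = p.θs N' → N = N'
  θs_eig : ∀ N ≤ p.n, Module.End.HasEigenvalue As (p.θs N)

/-! ### Dynamical operators

The entries of the matrix `K(u)` of the reflection algebra presentation, and the gauge transformed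
(dynamical) operators `ℬ^ε(u, m)`, `𝒞^ε(u, m)`. -/

/-- `η̄(u) = (q + q⁻¹) ρ⁻¹ (η u + η* u⁻¹)`. -/
def Params.etaBar (p : Params) (u : ℂ) : ℂ := (p.q + p.q⁻¹) * p.ρ⁻¹ * (p.η * u + p.ηs * u⁻¹)

/-- The entry `K₁₁(u)`. -/
def K₁₁ (p : Params) (A As : Module.End ℂ V) (u : ℂ) : Module.End ℂ V :=
  bf (u ^ 2) • ((p.q * u) • A - (p.q⁻¹ * u⁻¹) • As) - p.etaBar u • 1

/-- The entry `K₂₂(u)`. -/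
def K₂₂ (p : Params) (A As : Module.End ℂ V) (u : ℂ) : Module.End ℂ V :=
  bf (u ^ 2) • ((p.q * u) • As - (p.q⁻¹ * u⁻¹) • A) - p.etaBar u⁻¹ • 1

/-- The entry `K₁₂(u)`. -/
def K₁₂ (p : Params) (A As : Module.End ℂ V) (u : ℂ) : Module.End ℂ V :=
  (p.χ * bf (u ^ 2)) • (p.ρ⁻¹ • (qComm p.q As A + (p.ω / (p.q - p.q⁻¹)) • 1)
    + ((p.q * u ^ 2 + p.q⁻¹ * u ^ (-2 : ℤ)) / (p.q ^ 2 - p.q ^ (-2 : ℤ))) • 1)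

/-- The entry `K₂₁(u)`. -/
def K₂₁ (p : Params) (A As : Module.End ℂ V) (u : ℂ) : Module.End ℂ V :=
  (p.ρ * p.χ⁻¹ * bf (u ^ 2)) • (p.ρ⁻¹ • (qComm p.q A As + (p.ω / (p.q - p.q⁻¹)) • 1)
    + ((p.q * u ^ 2 + p.q⁻¹ * u ^ (-2 : ℤ)) / (p.q ^ 2 - p.q ^ (-2 : ℤ))) • 1)

/-- `γ^ε(u, m) = α^{(1-ε)/2} β^{(1+ε)/2} q^{-m} u - α^{(1+ε)/2} β^{(1-ε)/2} q^m u⁻¹`, for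
`ε = ±1`. -/
def gammaFn (p : Params) (ε : ℤ) (α β u : ℂ) (m : ℤ) : ℂ :=
  α ^ ((1 - ε) / 2) * β ^ ((1 + ε) / 2) * p.q ^ (-m) * u
    - α ^ ((1 + ε) / 2) * β ^ ((1 - ε) / 2) * p.q ^ m * u⁻¹

/-- The dynamical operator `ℬ^ε(u, m)`, for `ε = ±1`: up to a normalizing scalar it is the product
of the row `(1, -y u^ε)`, the matrix `K(u)`, and the column `(y u^{-ε}, 1)`, with
`y = β q^{-ε m}`. -/
def dynB (p : Params) (A As : Module.End ℂ V) (ε : ℤ) (α β u : ℂ) (m : ℤ) : Module.End ℂ V :=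
  (-(ε : ℂ) * (p.q * u) ^ (-ε) / gammaFn p ε α β 1 (m + 1)) •
    (K₁₂ p A As u
      + (β * p.q ^ (-ε * m) * u ^ (-ε)) • K₁₁ p A As u
      - (β * p.q ^ (-ε * m) * u ^ ε) • K₂₂ p A As u
      - (β * p.q ^ (-ε * m)) ^ 2 • K₂₁ p A As u)

/-- The dynamical operator `𝒞^ε(u, m)`, for `ε = ±1`: up to a normalizing scalar it is the product
of the row `(1, -x u^ε)`, the matrix `K(u)`, and the column `(x u^{-ε}, 1)`, with
`x = α q^{ε m}`. -/
def dynC (p : Params) (A As : Module.End ℂ V) (ε : ℤ) (α β u : ℂ) (m : ℤ) : Module.End ℂ V :=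
  ((ε : ℂ) * (p.q * u) ^ (-ε) / gammaFn p ε α β 1 (m - 1)) •
    (K₁₂ p A As u
      + (α * p.q ^ (ε * m) * u ^ (-ε)) • K₁₁ p A As u
      - (α * p.q ^ (ε * m) * u ^ ε) • K₂₂ p A As u
      - (α * p.q ^ (ε * m)) ^ 2 • K₂₁ p A As u)

/-- The string `ℬ^ε(u_1, m+2(M-1)) ⋯ ℬ^ε(u_M, m)`. -/
def stringB (p : Params) (A As : Module.End ℂ V) (ε : ℤ) (α β : ℂ) (m : ℤ) {M : ℕ}
    (u : Fin M → ℂ) : Module.End ℂ V :=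
  (List.ofFn fun i : Fin M =>
    dynB p A As ε α β (u i) (m + 2 * ((M : ℤ) - 1 - ((i : ℕ) : ℤ)))).prod

/-- The string `𝒞^ε(v_1, m+2) ⋯ 𝒞^ε(v_N, m+2N)`. -/
def stringC (p : Params) (A As : Module.End ℂ V) (ε : ℤ) (α β : ℂ) (m : ℤ) {N : ℕ}
    (v : Fin N → ℂ) : Module.End ℂ V :=
  (List.ofFn fun i : Fin N =>
    dynC p A As ε α β (v i) (m + 2 * (((i : ℕ) : ℤ) + 1))).prod

/-- The Bethe state `|Ψ_ε^M(u, m)⟩` on the reference state `Ω`, with gauge parameters `α` and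
`β = 0`. -/
def betheKet (p : Params) (A As : Module.End ℂ V) (ε : ℤ) (α : ℂ) (m : ℤ) (Ω : V) {M : ℕ}
    (u : Fin M → ℂ) : V :=
  stringB p A As ε α 0 m u Ω

/-- The dual Bethe state `⟨Ψ_ε^N(v, m)|` on the dual reference state `Ω'`, with gauge parameters
`α = 0` and `β`. -/
def betheBra (p : Params) (A As : Module.End ℂ V) (ε : ℤ) (β : ℂ) (m : ℤ)
    (Ω' : Module.Dual ℂ V) {N : ℕ} (v : Fin N → ℂ) : Module.Dual ℂ V :=
  Ω' ∘ₗ stringC p A As ε 0 β m v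

end Operators

/-! ### Bethe equations of homogeneous type -/

namespace Params

/-- `f(u, v) = b(q v / u) b(u v) / (b(v / u) b(q u v))`. -/
def f (p : Params) (u v : ℂ) : ℂ :=
  bf (p.q * v / u) * bf (u * v) / (bf (v / u) * bf (p.q * u * v))

/-- `h(u, v) = b(q² u v) b(q u / v) / (b(q u v) b(u / v))`. -/
def h (p : Params) (u v : ℂ) : ℂ :=
  bf (p.q ^ 2 * u * v) * bf (p.q * u / v) / (bf (p.q * u * v) * bf (u / v))

/-- `Λ_1^ε(u)`, for `ε = ±1`. -/
def Λ₁ (p : Params) (ε : ℤ) (u : ℂ) : ℂ :=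
  p.q ^ (-(p.n : ℤ) - 1) / u ^ ε
    * (p.q ^ (p.n + 1) * u * p.ζ⁻¹ - u⁻¹ * p.ζ) * (p.q ^ (p.n + 1) * u * p.ζ - u⁻¹ * p.ζ⁻¹)
    * (u * p.cs * p.q ^ (-(p.n : ℤ)) + u⁻¹ * p.b * p.q ^ p.n)
    * (u * (p.c / p.cs) ^ ((1 - ε) / 2) + u⁻¹ * (p.bs / p.b) ^ ((1 + ε) / 2))

/-- `Λ_2^ε(u)`, for `ε = ±1`. -/
def Λ₂ (p : Params) (ε : ℤ) (u : ℂ) : ℂ :=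
  (u ^ 2 - u ^ (-2 : ℤ)) * p.q ^ (-(p.n : ℤ) - 1)
      / (u ^ ε * (p.q * u ^ 2 - p.q⁻¹ * u ^ (-2 : ℤ)))
    * (p.q ^ ((p.n : ℤ) - 1) * u⁻¹ * p.ζ - u * p.ζ⁻¹)
    * (p.q ^ ((p.n : ℤ) - 1) * u⁻¹ * p.ζ⁻¹ - u * p.ζ)
    * (p.q ^ 2 * u * p.b * p.q ^ p.n + u⁻¹ * p.cs * p.q ^ (-(p.n : ℤ)))
    * (p.q ^ 2 * u * (p.bs / p.b) ^ ((1 + ε) / 2) + u⁻¹ * (p.c / p.cs) ^ ((1 - ε) / 2))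

/-- The function `E_ε^M(u_i, ū_i)`, for `ε = ±1`. -/
def E (p : Params) (ε : ℤ) {M : ℕ} (u : Fin M → ℂ) (i : Fin M) : ℂ :=
  -(bf (u i ^ 2) / bf (p.q * u i ^ 2)) * (∏ j ∈ Finset.univ.erase i, p.f (u i) (u j))
      * p.Λ₁ ε (u i)
    + (∏ j ∈ Finset.univ.erase i, p.h (u i) (u j)) * p.Λ₂ ε (u i)

/-- The symmetrized Bethe root `U = (q u² + q⁻¹ u⁻²) / (q + q⁻¹)`. -/
def symRoot (p : Params) (u : ℂ) : ℂ := (p.q * u ^ 2 + p.q⁻¹ * u ^ (-2 : ℤ)) / (p.q + p.q⁻¹)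

/-- `u` is a non-trivial admissible set of Bethe roots for the homogeneous Bethe equations
`E_ε^M(u_i, ū_i) = 0`. The condition `b(q u_i²) ≠ 0` says that these functions are defined at `u`;
the other denominators do not vanish by admissibility. -/
structure IsBetheSolution (p : Params) (ε : ℤ) {M : ℕ} (u : Fin M → ℂ) : Prop where
  ne_zero : ∀ i, u i ≠ 0
  nontrivial : ∀ i, u i ^ 2 ≠ u i ^ (-2 : ℤ)
  defined : ∀ i, bf (p.q * u i ^ 2) ≠ 0
  admissible : ∀ i j, i ≠ j → p.symRoot (u i) ≠ p.symRoot (u j)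
  bethe : ∀ i, p.E ε u i = 0

/-- The normalization factor `𝒩*_N(v) = ∏_{k=1}^N (-q⁻¹ v_k⁻¹ b(v_k²) A_{k,k-1})⁻¹`. -/
def normStar (p : Params) {N : ℕ} (v : Fin N → ℂ) : ℂ :=
  ∏ k : Fin N, (-p.q⁻¹ * (v k)⁻¹ * bf (v k ^ 2) * p.ASub ((k : ℕ) + 1))⁻¹

end Params

end BetheRacah

end

/-!
Why the theorem is true. With gauge parameter `β = 0` (kets) or `α = 0` (bra) only the entry
`K₁₂(u)` survives in the dynamical operators. It equals a scalar times `X - x(u)`, where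
`X = [A*, A]_q + ω / (q - q⁻¹)` is the shifted `q`-commutator and `x(u)` is an explicit number
(`K₁₂_eq`). All Bethe states are therefore scalars times `P(X) Ω`, where `P = ∏ (x - x(u_i))` is
the Bethe polynomial (`stringB_eq`, `stringC_eq`), and the order of the factors is irrelevant.

*On-shell states are eigenvectors.* The Askey-Wilson relations imply a relation that is quadratic
in `X` and linear in `A` (`IsXPair.cubic`), and `A X Ω ∈ θ_1 X Ω + ℂ Ω` for a reference vector `Ω`
(`IsAWPair.apply_apply_reference`). Hence `A P(X) Ω = (D P)(X) Ω` for a linear operator `D` on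
polynomials, which is triangular with diagonal `θ_k` (`degree_diffOp_sub_lt`) and which, at a zero
`x(u)` of `P`, only sees the values at `x(q u)` and `x(q⁻¹ u)` (`Valid.eval_diffOp`). The two weights
are proportional to `Λ_2` and `Λ_1`, so the Bethe equations say precisely that `D P - θ_M P`, a
polynomial of degree less than `M`, vanishes at the `M` distinct zeros of `P`; it is zero
(`IsBetheSolution.diffOp_bethePoly`). The state `P(X) Ω` does not vanish because `Ω` is cyclic for `X`
(`IsXPair.aeval_apply_ne_zero`). The exchange `(b, c, ζ) ↔ (b*, c*, ζ⁻¹)` and transposition carry this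
over to the eigenvectors and eigencovectors of `A*`.

*The `₄φ₃`.* On the dual space, the covectors `(A - θ_{k-1}) ⋯ (A - θ_0) Ω'` form a basis in which
`A*` is bidiagonal (`IsAWPair.apply_splitVec_succ`). Its off-diagonal entries, the split sequence,
are nonzero by irreducibility (`IsAWPair.splitCoeff_ne_zero`), which gives the nonvanishing of the
denominators of the `₄φ₃`. Solving the bidiagonal recursion yields the eigencovector `g_N` of `A*` for
`θ*_N`; evaluated at an eigenvector `x` of `A` for `θ_M` it is `R_M(θ*_N) ⟨Ω', x⟩`, term by term
(`IsAWPair.racahVec_apply`).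

*The normalization.* The bra is `l • g_N`, and the unknown factor `l` cancels in the quotient. It
remains to evaluate `g_N` at the ket `|Ψ_+^N⟩`. The operator `A` is tridiagonal in the basis `g_N`
with lower coefficients `A_{N,N-1}` (`IsAWPair.apply_racahVec_three_term`), hence so is `X`, and only
the leading monomial `X^N` of the Bethe polynomial contributes: the value is the product of the
lower coefficients (`IsAWPair.racahVec_aeval_apply`), that is `𝒩*_N(v)⁻¹ ⟨Ω', Ω⟩`
(`IsAWPair.racahVec_betheKet`).
-/

noncomputable section

namespace BetheRacah

open Module Polynomial

/-! ### Parameters, duality and the spectrum of an Askey-Wilson pair -/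

section

namespace Params

variable {p : Params}

theorem θ_eq (p : Params) (M : ℕ) : p.θ M = p.b * p.q ^ (2 * M) + p.c * (p.q ^ (2 * M))⁻¹ := by
  simp only [θ]
  rw [neg_mul, zpow_neg]
  norm_cast

theorem θs_eq (p : Params) (M : ℕ) : p.θs M = p.bs * p.q ^ (2 * M) + p.cs * (p.q ^ (2 * M))⁻¹ :=
  θ_eq p.swap M

theorem Valid.sq_sub_ne (hp : p.Valid) : p.q ^ 2 - p.q ^ (-2 : ℤ) ≠ 0 := by
  intro h
  have := hp.q_not_root 4 (by norm_num)
  have hq := hp.q_ne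
  apply this
  field_simp at h
  linear_combination h

theorem Valid.sub_inv_ne (hp : p.Valid) : p.q - p.q⁻¹ ≠ 0 := by
  intro h
  have := hp.q_not_root 2 (by norm_num)
  have hq := hp.q_ne
  apply this
  field_simp at h
  linear_combination h

theorem Valid.add_inv_ne (hp : p.Valid) : p.q + p.q⁻¹ ≠ 0 := by
  intro h
  have := hp.q_not_root 4 (by norm_num)
  have hq := hp.q_ne
  apply this
  field_simp at h
  linear_combination (p.q ^ 2 - 1) * h

theorem Valid.ρ_ne (hp : p.Valid) : p.ρ ≠ 0 :=
  mul_ne_zero (neg_ne_zero.2 (mul_ne_zero hp.b_ne hp.c_ne)) (pow_ne_zero _ hp.sq_sub_ne)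

theorem Valid.swap (hp : p.Valid) : p.swap.Valid where
  q_ne := hp.q_ne
  q_not_root := hp.q_not_root
  b_ne := hp.bs_ne
  c_ne := hp.cs_ne
  bs_ne := hp.b_ne
  cs_ne := hp.c_ne
  ζ_ne := inv_ne_zero hp.ζ_ne
  χ_ne := hp.χ_ne
  bc_eq := hp.bc_eq.symm
  generic := hp.generic_star
  generic_star := hp.generic

theorem Valid.ρ_swap (hp : p.Valid) : p.swap.ρ = p.ρ := by
  simp only [ρ, Params.swap, hp.bc_eq]

theorem Valid.ω_swap (hp : p.Valid) : p.swap.ω = p.ω := by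
  simp only [ω, Params.swap, hp.bc_eq, inv_pow, zpow_neg, inv_zpow, inv_inv]
  norm_cast
  ring

theorem η_swap (p : Params) : p.swap.η = p.ηs := by
  simp only [η, ηs, Params.swap, inv_pow, zpow_neg, inv_zpow, inv_inv]
  norm_cast
  ring

theorem ηs_swap (p : Params) : p.swap.ηs = p.η := by
  simp only [η, ηs, Params.swap, inv_pow, zpow_neg, inv_zpow, inv_inv]
  norm_cast
  ring

/-- The number `θ_{-1}` continuing the eigenvalue sequence of `A` to the left. -/
def θNeg (p : Params) : ℂ := p.b * (p.q ^ 2)⁻¹ + p.c * p.q ^ 2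

/-- The coefficient `κ` in `(A - θ_1) A* Ω = κ Ω` for `A Ω = θ_0 Ω`. -/
def κ (p : Params) : ℂ := (p.ω * p.θ 0 + p.η) / (p.θ 0 - p.θNeg)

theorem Valid.θNeg_ne (hp : p.Valid) : ∀ k ≤ p.n, p.θNeg ≠ p.θ k := by
  intro k hk h
  have hq := hp.q_ne
  have h1 : p.q ^ (2 * k + 2) ≠ 1 := hp.q_not_root _ (by omega)
  have h2 := hp.generic (k - 1) (by omega) (by omega)
  have h3 : p.q ^ (2 * ((k : ℤ) - 1)) = p.q ^ (2 * k) * (p.q ^ 2)⁻¹ := by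
    rw [mul_sub, zpow_sub₀ hq, mul_one, div_eq_mul_inv]
    norm_cast
  rw [h3] at h2
  rw [θ_eq, θNeg] at h
  rw [pow_add] at h1
  have hx : p.q ^ (2 * k) ≠ 0 := pow_ne_zero _ hq
  generalize p.q ^ (2 * k) = x at *
  field_simp at h
  have : (p.c * p.q ^ 2 - p.b * x) * (x * p.q ^ 2 - 1) = 0 := by linear_combination h
  rcases mul_eq_zero.1 this with h4 | h4
  · exact h2 (by field_simp; linear_combination h4)
  · exact h1 (by linear_combination h4)

theorem Valid.θ_zero_sub_ne (hp : p.Valid) : p.θ 0 - p.θNeg ≠ 0 :=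
  sub_ne_zero.2 (hp.θNeg_ne 0 (Nat.zero_le _)).symm

end Params

variable {V : Type*} [AddCommGroup V] [Module ℂ V] {p : Params} {A As : End ℂ V}

/-- The double `q`-commutator in expanded form; it is invariant under reversal of all products. -/
theorem qComm_qComm {q : ℂ} (hq : q ≠ 0) (A B : End ℂ V) :
    qComm q⁻¹ A (qComm q A B)
      = A * A * B - (q ^ 2 + q ^ (-2 : ℤ)) • (A * B * A) + B * A * A := by
  simp only [qComm, mul_sub, sub_mul, smul_mul_assoc, mul_smul_comm, smul_sub, smul_smul, inv_inv,
    mul_assoc]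
  match_scalars <;> field_simp
  ring

/-- The reversed double `q`-commutator. -/
theorem qComm_qComm_comm {q : ℂ} (hq : q ≠ 0) (A B : End ℂ V) :
    qComm q⁻¹ (qComm q B A) A = qComm q⁻¹ A (qComm q A B) := by
  rw [qComm_qComm hq]
  simp only [qComm, mul_sub, sub_mul, smul_mul_assoc, mul_smul_comm, smul_sub, smul_smul, inv_inv,
    mul_assoc]
  match_scalars <;> field_simp
  ring

theorem dualMap_mul (f g : End ℂ V) : (f * g).dualMap = g.dualMap * f.dualMap := rfl

theorem dualMap_qComm (r : ℂ) (f g : End ℂ V) :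
    (qComm r f g).dualMap = qComm r g.dualMap f.dualMap := by
  ext φ x
  simp [qComm]

theorem hasEigenvalue_dualMap [FiniteDimensional ℂ V] {f : End ℂ V} {μ : ℂ}
    (h : f.HasEigenvalue μ) : Module.End.HasEigenvalue (M := Dual ℂ V) f.dualMap μ := by
  rw [Module.End.hasEigenvalue_iff_mem_spectrum, spectrum.mem_iff,
    LinearMap.isUnit_iff_isUnit_det] at h ⊢
  rw [← LinearMap.det_dualMap] at h
  convert h using 3
  ext φ x
  simp

namespace IsAWPair

theorem finiteDimensional (h : IsAWPair p A As) : FiniteDimensional ℂ V :=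
  Module.finite_of_finrank_pos (by rw [h.finrank_eq]; omega)

theorem swap (hp : p.Valid) (h : IsAWPair p A As) : IsAWPair p.swap As A where
  finrank_eq := h.finrank_eq
  aw₁ := by rw [hp.ρ_swap, hp.ω_swap, p.η_swap]; exact h.aw₂
  aw₂ := by rw [hp.ρ_swap, hp.ω_swap, p.ηs_swap]; exact h.aw₁
  irreducible W h₁ h₂ := h.irreducible W h₂ h₁
  θ_inj := h.θs_inj
  θ_eig := h.θs_eig
  θs_inj := h.θ_inj
  θs_eig := h.θ_eig

/-- The transposed operators form an Askey-Wilson pair on the dual space. -/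
theorem dual (hp : p.Valid) (h : IsAWPair p A As) :
    IsAWPair (V := Dual ℂ V) p A.dualMap As.dualMap := by
  have := h.finiteDimensional
  refine ⟨by rw [Subspace.dual_finrank_eq, h.finrank_eq], ?_, ?_, ?_, h.θ_inj, ?_, h.θs_inj, ?_⟩
  · rw [← qComm_qComm_comm hp.q_ne, ← dualMap_qComm, ← dualMap_qComm, h.aw₁]
    ext φ x
    simp
  · rw [← qComm_qComm_comm hp.q_ne, ← dualMap_qComm, ← dualMap_qComm, h.aw₂]
    ext φ x
    simp
  -- an invariant subspace of the dual has an invariant annihilator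
  · intro W h₁ h₂
    have key : ∀ f : End ℂ V, (∀ φ ∈ W, f.dualMap φ ∈ W) →
        ∀ x ∈ W.dualCoannihilator, f x ∈ W.dualCoannihilator := by
      intro f hf x hx
      rw [Submodule.mem_dualCoannihilator] at hx ⊢
      exact fun φ hφ => hx _ (hf φ hφ)
    have h3 := Subspace.dualCoannihilator_dualAnnihilator_eq (W := W)
    rcases h.irreducible _ (key A h₁) (key As h₂) with h0 | h0
    · right; rw [← h3, h0, Submodule.dualAnnihilator_bot]
    · left; rw [← h3, h0, Submodule.dualAnnihilator_top]
  · exact fun M hM => hasEigenvalue_dualMap (h.θ_eig M hM)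
  · exact fun M hM => hasEigenvalue_dualMap (h.θs_eig M hM)

/-- `A` is annihilated by the product of the `n + 1` factors `A - θ_k`. -/
theorem aeval_prod_eq_zero (h : IsAWPair p A As) :
    Polynomial.aeval A (∏ k ∈ Finset.range (p.n + 1), (Polynomial.X - Polynomial.C (p.θ k))) = 0 := by
  have := h.finiteDimensional
  have hdvd : (∏ k ∈ Finset.range (p.n + 1), (Polynomial.X - Polynomial.C (p.θ k))) ∣ A.charpoly := by
    refine Finset.prod_dvd_of_coprime ?_ ?_
    · intro i hi j hj hij
      refine Polynomial.isCoprime_X_sub_C_of_isUnit_sub (Ne.isUnit (sub_ne_zero.2 ?_))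
      intro h1
      simp only [Finset.coe_range, Set.mem_Iio] at hi hj
      exact hij (h.θ_inj i (by omega) j (by omega) h1)
    · intro i hi
      rw [Finset.mem_range] at hi
      rw [Polynomial.dvd_iff_isRoot, ← Module.End.hasEigenvalue_iff_isRoot_charpoly]
      exact h.θ_eig i (by omega)
  have heq := Polynomial.eq_of_monic_of_dvd_of_natDegree_le
    (Polynomial.monic_prod_X_sub_C _ _) (LinearMap.charpoly_monic A) hdvd (by
      rw [LinearMap.charpoly_natDegree, h.finrank_eq, Polynomial.natDegree_finsetProd_X_sub_C_eq_card,
        Finset.card_range])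
  rw [← heq, LinearMap.aeval_self_charpoly]

/-- The only eigenvalues of `A` are `θ_0, …, θ_n`. -/
theorem eq_zero_of_ne (h : IsAWPair p A As) {μ : ℂ} (hμ : ∀ k ≤ p.n, μ ≠ p.θ k) {x : V}
    (hx : A x = μ • x) : x = 0 := by
  have h1 : Polynomial.aeval A (∏ k ∈ Finset.range (p.n + 1),
      (Polynomial.X - Polynomial.C (p.θ k))) x = 0 := by
    rw [h.aeval_prod_eq_zero, LinearMap.zero_apply]
  rw [Module.End.aeval_apply_of_mem_apply_eq_smul hx, Polynomial.eval_prod] at h1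
  refine (smul_eq_zero.1 h1).resolve_left (Finset.prod_ne_zero_iff.2 fun k hk => ?_)
  rw [Finset.mem_range] at hk
  simpa [sub_eq_zero] using hμ k (by omega)

/-- If `AΩ = θ_0 Ω`, then `A*Ω` lies in the span of `Ω` and of the eigenspace for `θ_1`: the
Askey-Wilson relation restricts it to the eigenvalues `θ_0, θ_1, θ_{-1}`, and
`θ_{-1} = b q⁻² + c q²` does not occur in the spectrum. -/
theorem apply_apply_reference (hp : p.Valid) (h : IsAWPair p A As) {Ω : V}
    (hΩ : A Ω = p.θ 0 • Ω) : A (As Ω) = p.θ 1 • As Ω + p.κ • Ω := by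
  have hq := hp.q_ne
  have hden := hp.θ_zero_sub_ne
  have h1 := congrArg (fun f : End ℂ V => f Ω) h.aw₁
  simp only [qComm_qComm hq, LinearMap.add_apply, LinearMap.sub_apply, LinearMap.smul_apply,
    Module.End.mul_apply, hΩ, map_smul, Module.End.one_apply] at h1
  have hκ : p.κ * (p.θ 0 - p.θNeg) = p.ω * p.θ 0 + p.η := div_mul_cancel₀ _ hden
  have hsum : p.θ 1 + p.θNeg = (p.q ^ 2 + p.q ^ (-2 : ℤ)) * p.θ 0 := by
    simp only [Params.θ_eq, Params.θNeg]
    field_simp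
    ring
  have hprod : p.θ 1 * p.θNeg = p.θ 0 ^ 2 - p.ρ := by
    simp only [Params.θ_eq, Params.θNeg, Params.ρ]
    field_simp
    ring
  -- the component of `A* Ω` for `θ_{-1}` would be an eigenvector, hence it is zero
  have h2 : A (A (As Ω) - p.θ 1 • As Ω - p.κ • Ω)
      = p.θNeg • (A (As Ω) - p.θ 1 • As Ω - p.κ • Ω) := by
    simp only [map_sub, map_smul, hΩ]
    rw [← sub_eq_zero] at h1 ⊢
    rw [← h1]
    match_scalars
    · ring
    · linear_combination -hsum
    · linear_combination -hκ
    · linear_combination hprod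
  have h3 := h.eq_zero_of_ne hp.θNeg_ne h2
  rw [← sub_eq_zero, ← h3]
  module

end IsAWPair

end

/-! ### The shifted `q`-commutator -/

section

variable {V : Type*} [AddCommGroup V] [Module ℂ V] {p : Params} {A As : End ℂ V}

/-- In dimension `n + 1`, an operator with `n + 1` eigenvectors for distinct eigenvalues has
one-dimensional eigenspaces. -/
theorem exists_eq_smul_of_eigenvector {W : Type*} [AddCommGroup W] [Module ℂ W] {n : ℕ}
    (hn : finrank ℂ W = n + 1) {T : End ℂ W} {θ : ℕ → ℂ}
    (hθ : ∀ j ≤ n, ∀ k ≤ n, θ j = θ k → j = k) {x : ℕ → W} (hx0 : ∀ k ≤ n, x k ≠ 0)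
    (hx : ∀ k ≤ n, T (x k) = θ k • x k) {N : ℕ} (hN : N ≤ n) {y : W} (hy : T y = θ N • y) :
    ∃ a : ℂ, y = a • x N := by
  have hfin : FiniteDimensional ℂ W := Module.finite_of_finrank_pos (by omega)
  have hli : LinearIndependent ℂ (fun k : Fin (n + 1) => x k) := by
    refine Module.End.eigenvectors_linearIndependent' T (fun k : Fin (n + 1) => θ k) ?_ _ ?_
    · intro i j hij
      exact Fin.ext (hθ i (by omega) j (by omega) hij)
    · intro k
      exact ⟨Module.End.mem_eigenspace_iff.2 (hx k (by omega)), hx0 k (by omega)⟩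
  let B := basisOfLinearIndependentOfCardEqFinrank hli (by simp [hn])
  have hB : ∀ k, B k = x k := fun k => by simp [B]
  have hTB : ∀ k, T (B k) = θ k • B k := fun k => by rw [hB]; exact hx k (by omega)
  have hrepr : ∀ k, B.repr (T y) k = θ k * B.repr y k := by
    intro k
    conv_lhs => rw [← B.sum_repr y, map_sum]
    simp only [map_smul, hTB, map_sum, Basis.repr_self, Finsupp.finsetSum_apply,
      Finsupp.smul_apply, Finsupp.single_apply, smul_eq_mul]
    simp [mul_comm]
  refine ⟨B.repr y ⟨N, by omega⟩, ?_⟩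
  conv_lhs => rw [← B.sum_repr y]
  rw [Finset.sum_eq_single (⟨N, by omega⟩ : Fin (n + 1)), hB]
  · intro k _ hk
    have h1 := hrepr k
    rw [hy, map_smul, Finsupp.smul_apply, smul_eq_mul] at h1
    have h2 : (θ N - θ k) * B.repr y k = 0 := by linear_combination h1
    have h3 : θ N - θ k ≠ 0 := by
      intro h4
      exact hk (Fin.ext (hθ N hN k (by omega) (sub_eq_zero.1 h4)).symm)
    rw [(mul_eq_zero.1 h2).resolve_left h3, zero_smul]
  · simp

namespace Params

/-- The constant `ν` in `A X Ω = θ_1 X Ω + ν Ω` for `A Ω = θ_0 Ω`, where `X` is the shifted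
`q`-commutator of the Askey-Wilson pair. -/
def ν (p : Params) : ℂ :=
  p.κ * (p.q - p.q⁻¹) * p.θ 0 + p.ω / (p.q - p.q⁻¹) * (p.θ 0 - p.θ 1)

end Params

/-- The shifted `q`-commutator `[A*, A]_q + ω / (q - q⁻¹)`, the only operator entering `K₁₂`. -/
def shiftedComm (p : Params) (A As : End ℂ V) : End ℂ V :=
  qComm p.q As A + (p.ω / (p.q - p.q⁻¹)) • 1

/-- The relations that tie the operators `A` and `X` together, as far as they matter for the
action of polynomials in `X` on an eigenvector `Ω` of `A`. They hold for both orderings of the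
`q`-commutator. -/
structure IsXPair (p : Params) (A X : End ℂ V) : Prop where
  cubic : X * X * A - (p.q ^ 2 + p.q ^ (-2 : ℤ)) • (X * A * X) + A * X * X
    = -p.ρ ^ 2 • A + ((p.q - p.q⁻¹) * p.η) • X - (p.ρ * p.ηs) • 1
  irreducible : ∀ W : Submodule ℂ V, (∀ x ∈ W, A x ∈ W) → (∀ x ∈ W, X x ∈ W) → W = ⊥ ∨ W = ⊤
  reference : ∀ Ω : V, A Ω = p.θ 0 • Ω → A (X Ω) = p.θ 1 • X Ω + p.ν • Ω

namespace IsAWPair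

/-- The relations follow by eliminating `A*` through `ρ A* = [[A*, A]_q, A]_{q⁻¹} - ω A - η`. -/
theorem isXPair (hp : p.Valid) (h : IsAWPair p A As) : IsXPair p A (shiftedComm p A As) := by
  have hq := hp.q_ne
  have hs : p.q ^ 2 - 1 ≠ 0 := sub_ne_zero.2 (hp.q_not_root 2 two_pos)
  have hρ := hp.ρ_ne
  have hAs : p.ρ • As = qComm p.q⁻¹ (qComm p.q As A) A - p.ω • A - p.η • 1 := by
    rw [qComm_qComm_comm hq, h.aw₁]; abel
  have h2 : qComm p.q⁻¹ As (qComm p.q As A) = p.ρ • A + p.ω • As + p.ηs • 1 := h.aw₂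
  set Y := qComm p.q As A with hY
  have hX : shiftedComm p A As = Y + (p.ω / (p.q - p.q⁻¹)) • 1 := rfl
  refine ⟨?_, ?_, ?_⟩
  · rw [hX]
    have h3 := congrArg (p.ρ • ·) h2
    have h4 : p.ρ • qComm p.q⁻¹ As Y = qComm p.q⁻¹ (p.ρ • As) Y := by
      simp only [qComm, smul_mul_assoc, mul_smul_comm, smul_sub, smul_comm p.ρ]
    have h5 : p.ρ • p.ω • As = p.ω • (p.ρ • As) := smul_comm _ _ _
    simp only [h4, smul_add, h5, hAs] at h3
    rw [← sub_eq_zero] at h3 ⊢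
    rw [← neg_eq_zero, ← h3]
    simp only [qComm, mul_add, add_mul, mul_sub, sub_mul, smul_mul_assoc, mul_smul_comm, smul_sub,
      smul_add, smul_smul, inv_inv, mul_assoc, mul_one, one_mul]
    match_scalars <;> field_simp <;> ring
  · intro W hA hXW
    refine h.irreducible W hA fun x hx => ?_
    have hYW : ∀ x ∈ W, Y x ∈ W := fun x hx => by
      have := W.sub_mem (hXW x hx) (W.smul_mem (p.ω / (p.q - p.q⁻¹)) hx)
      simpa [hX] using this
    have h3 : p.ρ • As x ∈ W := by
      rw [← LinearMap.smul_apply, hAs]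
      simp only [qComm, LinearMap.sub_apply, LinearMap.smul_apply, Module.End.mul_apply,
        Module.End.one_apply]
      exact W.sub_mem (W.sub_mem (W.sub_mem (W.smul_mem _ (hYW _ (hA _ hx)))
        (W.smul_mem _ (hA _ (hYW _ hx)))) (W.smul_mem _ (hA _ hx))) (W.smul_mem _ hx)
    exact (W.smul_mem_iff hρ).1 h3
  · intro Ω hΩ
    have h3 := h.apply_apply_reference hp hΩ
    rw [hX, hY]
    simp only [qComm, LinearMap.add_apply, LinearMap.sub_apply, LinearMap.smul_apply,
      Module.End.mul_apply, Module.End.one_apply, hΩ, h3, map_add, map_sub, map_smul, Params.ν]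
    match_scalars <;> field_simp
    ring

/-- The operator `A*` satisfies the exchanged relations with the same `X = [A*, A]_q + ω / (q - q⁻¹)`,
not with the `q`-commutator in the opposite order. -/
theorem isXPair_swap (hp : p.Valid) (h : IsAWPair p A As) :
    IsXPair p.swap As (shiftedComm p A As) := by
  have hq := hp.q_ne
  have hs : p.q ^ 2 - 1 ≠ 0 := sub_ne_zero.2 (hp.q_not_root 2 two_pos)
  have hρ := hp.ρ_ne
  have hAs : p.ρ • A = qComm p.q⁻¹ As (qComm p.q As A) - p.ω • As - p.ηs • 1 := by
    rw [h.aw₂]; abel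
  have h2 : qComm p.q⁻¹ (qComm p.q As A) A = p.ρ • As + p.ω • A + p.η • 1 := by
    rw [qComm_qComm_comm hq, h.aw₁]
  have hqs : p.swap.q = p.q := rfl
  set Y := qComm p.q As A with hY
  have hX : shiftedComm p A As = Y + (p.ω / (p.q - p.q⁻¹)) • 1 := rfl
  refine ⟨?_, ?_, ?_⟩
  · rw [hX, hqs, hp.ρ_swap, p.η_swap, p.ηs_swap]
    have h3 := congrArg (p.ρ • ·) h2
    have h4 : p.ρ • qComm p.q⁻¹ Y A = qComm p.q⁻¹ Y (p.ρ • A) := by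
      simp only [qComm, smul_mul_assoc, mul_smul_comm, smul_sub, smul_comm p.ρ]
    have h5 : p.ρ • p.ω • A = p.ω • (p.ρ • A) := smul_comm _ _ _
    simp only [h4, smul_add, h5, hAs] at h3
    rw [← sub_eq_zero] at h3 ⊢
    rw [← neg_eq_zero, ← h3]
    simp only [qComm, mul_add, add_mul, mul_sub, sub_mul, smul_mul_assoc, mul_smul_comm, smul_sub,
      smul_add, smul_smul, inv_inv, mul_assoc, mul_one, one_mul]
    match_scalars <;> field_simp <;> ring
  · intro W hA hXW
    refine h.irreducible W (fun x hx => ?_) hA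
    have hYW : ∀ x ∈ W, Y x ∈ W := fun x hx => by
      have := W.sub_mem (hXW x hx) (W.smul_mem (p.ω / (p.q - p.q⁻¹)) hx)
      simpa [hX] using this
    have h3 : p.ρ • A x ∈ W := by
      rw [← LinearMap.smul_apply, hAs]
      simp only [qComm, LinearMap.sub_apply, LinearMap.smul_apply, Module.End.mul_apply,
        Module.End.one_apply]
      exact W.sub_mem (W.sub_mem (W.sub_mem (W.smul_mem _ (hA _ (hYW _ hx)))
        (W.smul_mem _ (hYW _ (hA _ hx)))) (W.smul_mem _ (hA _ hx))) (W.smul_mem _ hx)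
    exact (W.smul_mem_iff hρ).1 h3
  · intro Ω hΩ
    have h3 := (h.swap hp).apply_apply_reference hp.swap hΩ
    rw [hX, hY]
    simp only [qComm, LinearMap.add_apply, LinearMap.sub_apply, LinearMap.smul_apply,
      Module.End.mul_apply, Module.End.one_apply, hΩ, h3, map_add, map_sub, map_smul, Params.ν, hqs,
      hp.ω_swap]
    match_scalars <;> field_simp
    ring

theorem dualMap_shiftedComm (hp : p.Valid) :
    (shiftedComm p A As).dualMap = shiftedComm p.swap As.dualMap A.dualMap := by
  rw [shiftedComm, shiftedComm, hp.ω_swap, ← show p.q = p.swap.q from rfl, ← dualMap_qComm]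
  ext φ x
  simp

end IsAWPair

end

/-! ### Scalar identities for the difference operator -/

section

namespace Params

variable {p : Params}

theorem ρ_eq (p : Params) : p.ρ = -(p.b * p.c) * (p.q ^ 2 - (p.q ^ 2)⁻¹) ^ 2 := by
  simp only [ρ, zpow_neg]
  norm_cast

theorem Valid.ω_eq (hp : p.Valid) : p.ω = (p.q - p.q⁻¹) ^ 2 *
    (p.b * p.c * (p.ζ ^ 2 + (p.ζ ^ 2)⁻¹) * (p.q ^ p.n * p.q + (p.q ^ p.n)⁻¹ * p.q⁻¹)
      - (p.b * p.q ^ p.n + p.c * (p.q ^ p.n)⁻¹) * (p.bs * p.q ^ p.n + p.cs * (p.q ^ p.n)⁻¹)) := by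
  simp only [ω, zpow_neg, zpow_sub₀ hp.q_ne, div_eq_mul_inv, pow_succ, zpow_one]
  norm_cast

theorem Valid.η_eq (hp : p.Valid) : p.η =
    -((p.q ^ 2 - (p.q ^ 2)⁻¹) ^ 2 / (p.q + p.q⁻¹)) * (p.b * p.c) *
      ((p.b * p.q ^ p.n + p.c * (p.q ^ p.n)⁻¹) * (p.ζ ^ 2 + (p.ζ ^ 2)⁻¹)
        - (p.bs * p.q ^ p.n + p.cs * (p.q ^ p.n)⁻¹)
          * (p.q ^ p.n * p.q + (p.q ^ p.n)⁻¹ * p.q⁻¹)) := by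
  simp only [η, zpow_neg, zpow_sub₀ hp.q_ne, div_eq_mul_inv, pow_succ, zpow_one]
  norm_cast

theorem Valid.ηs_eq (hp : p.Valid) : p.ηs =
    -((p.q ^ 2 - (p.q ^ 2)⁻¹) ^ 2 / (p.q + p.q⁻¹)) * (p.b * p.c) *
      ((p.bs * p.q ^ p.n + p.cs * (p.q ^ p.n)⁻¹) * (p.ζ ^ 2 + (p.ζ ^ 2)⁻¹)
        - (p.b * p.q ^ p.n + p.c * (p.q ^ p.n)⁻¹)
          * (p.q ^ p.n * p.q + (p.q ^ p.n)⁻¹ * p.q⁻¹)) := by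
  rw [← η_swap, hp.swap.η_eq, hp.bc_eq]
  simp only [Params.swap, inv_pow, inv_inv]
  ring

/-- The element `φ_{k+1}` of the first split sequence, as a function of `y = q^{2k}`. -/
def splitCoeff (p : Params) (y : ℂ) : ℂ :=
  p.c * p.cs * (p.q ^ 2 * y ^ 2)⁻¹
    * (1 + p.b / p.cs * (p.q ^ p.n * p.q * y) * p.ζ ^ 2)
    * (1 + p.bs / p.c * (p.q ^ p.n * p.q * y) * (p.ζ ^ 2)⁻¹)
    * (1 - y * ((p.q ^ p.n) ^ 2)⁻¹) * (1 - p.q ^ 2 * y)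

theorem splitCoeff_swap (p : Params) (y : ℂ) : p.swap.splitCoeff y = p.splitCoeff y := by
  simp only [splitCoeff, Params.swap, inv_pow, inv_inv]
  ring

theorem Valid.sq_add_one_ne (hp : p.Valid) : p.q ^ 2 + 1 ≠ 0 := by
  intro h
  exact hp.q_not_root 4 (by norm_num) (by linear_combination (p.q ^ 2 - 1) * h)

theorem Valid.cs_eq (hp : p.Valid) : p.cs = p.b * p.c / p.bs := by
  have := hp.bs_ne
  field_simp
  linear_combination -hp.bc_eq

/-- In the split form of the pair, `κ` is determined by the first entry of the split sequence. -/
theorem Valid.κ_eq (hp : p.Valid) : p.κ = p.splitCoeff 1 - p.θs 0 * (p.θ 1 - p.θ 0) := by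
  have hq := hp.q_ne
  have hb := hp.b_ne
  have hc := hp.c_ne
  have hbs := hp.bs_ne
  have hζ := hp.ζ_ne
  have hQ : p.q ^ p.n ≠ 0 := pow_ne_zero _ hq
  have hd := hp.θ_zero_sub_ne
  have hs := hp.sq_add_one_ne
  rw [κ, div_eq_iff hd, hp.ω_eq, hp.η_eq]
  simp only [splitCoeff, θ_eq, θs_eq, θNeg, mul_zero, pow_zero, inv_one,
    mul_one, one_mul, pow_succ, hp.cs_eq]
  generalize p.q ^ p.n = Q at *
  field_simp
  ring

/-- The eigenvalue of the shifted `q`-commutator at which `K₁₂(u)` vanishes. -/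
def specX (p : Params) (u : ℂ) : ℂ :=
  -p.ρ * ((p.q * u ^ 2 + p.q⁻¹ * (u ^ 2)⁻¹) / (p.q ^ 2 - (p.q ^ 2)⁻¹))

/-- The weight of the shift `u ↦ q u` in the difference operator realizing `A`. -/
def weightUp (p : Params) (u : ℂ) : ℂ :=
  p.b * p.c * (p.q ^ 2 - (p.q ^ 2)⁻¹) * (p.q - p.q⁻¹) * (u * bf (u ^ 2))⁻¹ * p.Λ₂ (-1) u

/-- The weight of the shift `u ↦ q⁻¹ u` in the difference operator realizing `A`. -/
def weightDown (p : Params) (u : ℂ) : ℂ :=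
  -(p.b * p.c * (p.q ^ 2 - (p.q ^ 2)⁻¹) * (p.q - p.q⁻¹) * (u * bf (p.q * u ^ 2))⁻¹ * p.Λ₁ (-1) u)

theorem Valid.Λ₁_eq (hp : p.Valid) (u : ℂ) : p.Λ₁ (-1) u =
    (p.q ^ p.n)⁻¹ * p.q⁻¹ * u
    * (p.q ^ p.n * p.q * u * p.ζ⁻¹ - u⁻¹ * p.ζ) * (p.q ^ p.n * p.q * u * p.ζ - u⁻¹ * p.ζ⁻¹)
    * (u * p.cs * (p.q ^ p.n)⁻¹ + u⁻¹ * p.b * p.q ^ p.n)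
    * (u * (p.c / p.cs) + u⁻¹) := by
  simp only [Λ₁, zpow_neg, zpow_sub₀ hp.q_ne, zpow_one, zpow_natCast, pow_succ]
  simp only [show (1 - (-1) : ℤ) / 2 = 1 from rfl, show (1 + (-1) : ℤ) / 2 = 0 from rfl, zpow_one,
    zpow_zero, div_eq_mul_inv, inv_inv]
  ring

theorem Valid.Λ₂_eq (hp : p.Valid) (u : ℂ) : p.Λ₂ (-1) u =
    bf (u ^ 2) * (p.q ^ p.n)⁻¹ * p.q⁻¹ * u * (bf (p.q * u ^ 2))⁻¹
    * (p.q ^ p.n * p.q⁻¹ * u⁻¹ * p.ζ - u * p.ζ⁻¹) * (p.q ^ p.n * p.q⁻¹ * u⁻¹ * p.ζ⁻¹ - u * p.ζ)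
    * (p.q ^ 2 * u * p.b * p.q ^ p.n + u⁻¹ * p.cs * (p.q ^ p.n)⁻¹)
    * (p.q ^ 2 * u + u⁻¹ * (p.c / p.cs)) := by
  simp only [Λ₂, zpow_neg, zpow_sub₀ hp.q_ne, zpow_one, zpow_natCast, pow_succ, bf, mul_inv]
  simp only [show (1 - (-1) : ℤ) / 2 = 1 from rfl, show (1 + (-1) : ℤ) / 2 = 0 from rfl, zpow_one,
    zpow_zero, div_eq_mul_inv, mul_inv, inv_inv]
  norm_cast
  ring

theorem Valid.ν_eq (hp : p.Valid) :
    p.ν = (p.splitCoeff 1 - p.θs 0 * (p.θ 1 - p.θ 0)) * (p.q - p.q⁻¹) * p.θ 0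
      + (p.q - p.q⁻¹) *
    (p.b * p.c * (p.ζ ^ 2 + (p.ζ ^ 2)⁻¹) * (p.q ^ p.n * p.q + (p.q ^ p.n)⁻¹ * p.q⁻¹)
      - (p.b * p.q ^ p.n + p.c * (p.q ^ p.n)⁻¹) * (p.bs * p.q ^ p.n + p.cs * (p.q ^ p.n)⁻¹))
        * (p.θ 0 - p.θ 1) := by
  have h := hp.sub_inv_ne
  rw [ν, hp.κ_eq, hp.ω_eq]
  congr 2
  rw [div_eq_iff h]
  ring

theorem Valid.weightUp_mul (hp : p.Valid) {u : ℂ} (hu : u ≠ 0) (hb1 : bf (u ^ 2) ≠ 0)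
    (hb2 : bf (p.q * u ^ 2) ≠ 0) :
    p.weightUp u * bf (p.q * u ^ 2) =
      p.b * p.c * (p.q ^ 2 - (p.q ^ 2)⁻¹) * (p.q - p.q⁻¹) * (p.q ^ p.n)⁻¹ * p.q⁻¹
    * (p.q ^ p.n * p.q⁻¹ * u⁻¹ * p.ζ - u * p.ζ⁻¹) * (p.q ^ p.n * p.q⁻¹ * u⁻¹ * p.ζ⁻¹ - u * p.ζ)
    * (p.q ^ 2 * u * p.b * p.q ^ p.n + u⁻¹ * p.cs * (p.q ^ p.n)⁻¹)
    * (p.q ^ 2 * u + u⁻¹ * (p.c / p.cs)) := by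
  rw [weightUp, hp.Λ₂_eq]
  generalize bf (u ^ 2) = x at *
  generalize bf (p.q * u ^ 2) = y at *
  rw [mul_inv]
  linear_combination (p.b * p.c * (p.q ^ 2 - (p.q ^ 2)⁻¹) * (p.q - p.q⁻¹) * (p.q ^ p.n)⁻¹ * p.q⁻¹
    * (p.q ^ p.n * p.q⁻¹ * u⁻¹ * p.ζ - u * p.ζ⁻¹) * (p.q ^ p.n * p.q⁻¹ * u⁻¹ * p.ζ⁻¹ - u * p.ζ)
    * (p.q ^ 2 * u * p.b * p.q ^ p.n + u⁻¹ * p.cs * (p.q ^ p.n)⁻¹)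
    * (p.q ^ 2 * u + u⁻¹ * (p.c / p.cs))) *
    (u⁻¹ * u * x⁻¹ * x * mul_inv_cancel₀ hb2 + u⁻¹ * u * inv_mul_cancel₀ hb1 + inv_mul_cancel₀ hu)

theorem Valid.weightDown_mul (hp : p.Valid) {u : ℂ} (hu : u ≠ 0) (hb2 : bf (p.q * u ^ 2) ≠ 0) :
    p.weightDown u * bf (p.q * u ^ 2) =
      -(p.b * p.c * (p.q ^ 2 - (p.q ^ 2)⁻¹) * (p.q - p.q⁻¹) * (p.q ^ p.n)⁻¹ * p.q⁻¹
    * (p.q ^ p.n * p.q * u * p.ζ⁻¹ - u⁻¹ * p.ζ) * (p.q ^ p.n * p.q * u * p.ζ - u⁻¹ * p.ζ⁻¹)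
    * (u * p.cs * (p.q ^ p.n)⁻¹ + u⁻¹ * p.b * p.q ^ p.n)
    * (u * (p.c / p.cs) + u⁻¹)) := by
  rw [weightDown, hp.Λ₁_eq]
  generalize bf (p.q * u ^ 2) = y at *
  rw [mul_inv]
  linear_combination -(p.b * p.c * (p.q ^ 2 - (p.q ^ 2)⁻¹) * (p.q - p.q⁻¹) * (p.q ^ p.n)⁻¹ * p.q⁻¹
    * (p.q ^ p.n * p.q * u * p.ζ⁻¹ - u⁻¹ * p.ζ) * (p.q ^ p.n * p.q * u * p.ζ - u⁻¹ * p.ζ⁻¹)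
    * (u * p.cs * (p.q ^ p.n)⁻¹ + u⁻¹ * p.b * p.q ^ p.n)
    * (u * (p.c / p.cs) + u⁻¹)) *
    (u⁻¹ * u * inv_mul_cancel₀ hb2 + inv_mul_cancel₀ hu)

set_option maxHeartbeats 1000000 in
/-- The weights have the right sum for the difference operator to send `X` to `θ_1 X + ν`. -/
theorem Valid.weight_add (hp : p.Valid) {u : ℂ} (hu : u ≠ 0) (hb1 : bf (u ^ 2) ≠ 0)
    (hb2 : bf (p.q * u ^ 2) ≠ 0) :
    p.weightUp u + p.weightDown u = (p.θ 1 - p.θ 0) * p.specX u + p.ν := by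
  have hq := hp.q_ne
  have hb := hp.b_ne
  have hc := hp.c_ne
  have hbs := hp.bs_ne
  have hζ := hp.ζ_ne
  have hQ : p.q ^ p.n ≠ 0 := pow_ne_zero _ hq
  have hs : p.q ^ 4 - 1 ≠ 0 := sub_ne_zero.2 (hp.q_not_root 4 (by norm_num))
  refine mul_right_cancel₀ hb2 ?_
  rw [add_mul, hp.weightUp_mul hu hb1 hb2, hp.weightDown_mul hu hb2]
  simp only [hp.ν_eq, splitCoeff, specX, θ_eq, θs_eq, bf,
    ρ_eq, hp.cs_eq, mul_zero, pow_zero, inv_one, mul_one, pow_succ,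
    one_mul]
  generalize p.q ^ p.n = Q at *
  field_simp
  ring

set_option maxHeartbeats 2000000 in
/-- The weights have the right first moment for the difference operator to act correctly on `X²`.
Together with `Valid.weight_add` this determines them, which is where the product form of `Λ_1` and
`Λ_2` comes from. -/
theorem Valid.weight_add_mul (hp : p.Valid) {u : ℂ} (hu : u ≠ 0) (hb1 : bf (u ^ 2) ≠ 0)
    (hb2 : bf (p.q * u ^ 2) ≠ 0) :
    p.weightUp u * p.specX (p.q * u) + p.weightDown u * p.specX (p.q⁻¹ * u)
      = ((p.q ^ 2 + p.q ^ (-2 : ℤ)) - 1) * p.specX u * (p.θ 1 * p.specX u + p.ν)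
        - (p.specX u ^ 2 + p.ρ ^ 2) * p.θ 0 + (p.q - p.q⁻¹) * p.η * p.specX u - p.ρ * p.ηs := by
  have hq := hp.q_ne
  have hb := hp.b_ne
  have hc := hp.c_ne
  have hbs := hp.bs_ne
  have hζ := hp.ζ_ne
  have hQ : p.q ^ p.n ≠ 0 := pow_ne_zero _ hq
  have hs : p.q ^ 4 - 1 ≠ 0 := sub_ne_zero.2 (hp.q_not_root 4 (by norm_num))
  have hs2 := hp.sq_add_one_ne
  refine mul_right_cancel₀ hb2 ?_
  rw [add_mul, mul_right_comm (p.weightUp u), hp.weightUp_mul hu hb1 hb2,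
    mul_right_comm (p.weightDown u),
    hp.weightDown_mul hu hb2]
  simp only [hp.ν_eq, splitCoeff, specX, θ_eq, θs_eq, bf, hp.η_eq, hp.ηs_eq,
    ρ_eq, hp.cs_eq, mul_zero, pow_zero, inv_one, mul_one, pow_succ,
    one_mul, zpow_neg]
  generalize p.q ^ p.n = Q at *
  field_simp
  ring

end Params

end

/-! ### Polynomials in the shifted `q`-commutator on a reference vector -/

section

namespace Params

variable {p : Params}

/-- The polynomials `D_k` with `A X^k Ω = D_k(X) Ω` for `A Ω = θ_0 Ω`. -/
def monomialImage (p : Params) : ℕ → ℂ[X]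
  | 0 => C (p.θ 0)
  | 1 => C (p.θ 1) * X + C p.ν
  | k + 2 => C (p.q ^ 2 + p.q ^ (-2 : ℤ)) * (X * monomialImage p (k + 1))
      - X * (X * monomialImage p k) - C (p.ρ ^ 2) * monomialImage p k
      + C ((p.q - p.q⁻¹) * p.η) * X ^ (k + 1) - C (p.ρ * p.ηs) * X ^ k

/-- The linear operator on polynomials through which `A` acts on the vectors `P(X) Ω`, where
`A Ω = θ_0 Ω`. It is a `q`-difference operator in the spectral parameter of `X`. -/
def diffOp (p : Params) : ℂ[X] →ₗ[ℂ] ℂ[X] := (basisMonomials ℂ).constr ℂ p.monomialImage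

@[simp]
theorem diffOp_X_pow (p : Params) (k : ℕ) : p.diffOp (X ^ k) = p.monomialImage k := by
  have := (basisMonomials ℂ).constr_basis ℂ p.monomialImage k
  rw [coe_basisMonomials] at this
  rw [← monomial_one_right_eq_X_pow]
  exact this

theorem θ_add_two (p : Params) (hq : p.q ≠ 0) (k : ℕ) :
    p.θ (k + 2) = (p.q ^ 2 + p.q ^ (-2 : ℤ)) * p.θ (k + 1) - p.θ k := by
  have hx : p.q ^ (2 * k) ≠ 0 := pow_ne_zero _ hq
  simp only [θ_eq, mul_add, pow_add, zpow_neg]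
  norm_cast
  field_simp
  ring

/-- `D_k` has degree at most `k`, with coefficient `θ_k` in degree `k`. -/
theorem coeff_monomialImage (hq : p.q ≠ 0) : ∀ k m : ℕ, k ≤ m →
    (p.monomialImage k).coeff m = if m = k then p.θ k else 0
  | 0, m, _ => by simp [monomialImage, coeff_C]
  | 1, m, hm => by
    obtain ⟨m, rfl⟩ := Nat.exists_eq_add_of_le' hm
    simp [monomialImage, coeff_C]
  | k + 2, m, hm => by
    obtain ⟨m, rfl⟩ : ∃ j, m = j + 2 := Nat.exists_eq_add_of_le' (by omega)
    have h1 := coeff_monomialImage hq (k + 1) (m + 1) (by omega)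
    have h2 := coeff_monomialImage hq k m (by omega)
    have h3 := coeff_monomialImage hq k (m + 2) (by omega)
    rw [if_neg (by omega)] at h3
    simp only [monomialImage, coeff_add, coeff_sub, coeff_C_mul, coeff_X_mul, h1, h2, h3, coeff_X_pow,
      Nat.add_right_cancel_iff]
    rw [if_neg (show ¬ m + 2 = k + 1 by omega), if_neg (show ¬ m + 2 = k by omega)]
    split_ifs with h
    · rw [θ_add_two p hq]; ring
    · ring

theorem diffOp_eq_sum (p : Params) (P : ℂ[X]) :
    p.diffOp P = ∑ i ∈ Finset.range (P.natDegree + 1), C (P.coeff i) * p.monomialImage i := by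
  conv_lhs => rw [P.as_sum_range_C_mul_X_pow, map_sum]
  refine Finset.sum_congr rfl fun i _ => ?_
  rw [← smul_eq_C_mul, map_smul, diffOp_X_pow, smul_eq_C_mul]

/-- The difference operator is triangular with eigenvalues `θ_M`. -/
theorem degree_diffOp_sub_lt (hq : p.q ≠ 0) {P : ℂ[X]} {M : ℕ} (hP : P.natDegree = M) :
    (p.diffOp P - C (p.θ M) * P).degree < M := by
  rw [degree_lt_iff_coeff_zero]
  intro m hm
  rw [diffOp_eq_sum, coeff_sub, finsetSum_coeff, coeff_C_mul, hP]
  rcases hm.eq_or_lt with rfl | hm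
  · rw [Finset.sum_range_succ, coeff_C_mul, coeff_monomialImage hq _ _ le_rfl, if_pos rfl,
      Finset.sum_eq_zero, zero_add, mul_comm, sub_self]
    intro i hi
    rw [Finset.mem_range] at hi
    rw [coeff_C_mul, coeff_monomialImage hq _ _ hi.le, if_neg hi.ne', mul_zero]
  · rw [Finset.sum_eq_zero, coeff_eq_zero_of_natDegree_lt (hP ▸ hm), mul_zero, sub_zero]
    intro i hi
    rw [Finset.mem_range] at hi
    rw [coeff_C_mul, coeff_monomialImage hq _ _ (by omega), if_neg (by omega), mul_zero]

theorem Valid.specX_add (hp : p.Valid) (u : ℂ) : p.specX (p.q * u) + p.specX (p.q⁻¹ * u)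
    = (p.q ^ 2 + p.q ^ (-2 : ℤ)) * p.specX u := by
  have hq := hp.q_ne
  simp only [specX, zpow_neg, mul_pow, mul_inv, inv_pow, inv_inv]
  norm_cast
  field_simp
  ring

theorem Valid.specX_mul (hp : p.Valid) {u : ℂ} (hu : u ≠ 0) :
    p.specX (p.q * u) * p.specX (p.q⁻¹ * u) = p.specX u ^ 2 + p.ρ ^ 2 := by
  have hq := hp.q_ne
  have hs : p.q ^ 4 - 1 ≠ 0 := sub_ne_zero.2 (hp.q_not_root 4 (by norm_num))
  simp only [specX, mul_pow, mul_inv, inv_pow, inv_inv]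
  field_simp
  ring

/-- The difference operator at a zero `x(u)` of the polynomial: only the two shifted values of the
remaining factor enter, because `k ↦ D_{k+1}(x) - x D_k(x)` satisfies the linear recursion with the
characteristic roots `x(q u)` and `x(q⁻¹ u)`. -/
theorem Valid.eval_diffOp (hp : p.Valid) {u : ℂ} (hu : u ≠ 0) (hb1 : bf (u ^ 2) ≠ 0)
    (hb2 : bf (p.q * u ^ 2) ≠ 0) (Q : ℂ[X]) :
    (p.diffOp ((X - C (p.specX u)) * Q)).eval (p.specX u)
      = p.weightUp u * Q.eval (p.specX (p.q * u)) + p.weightDown u * Q.eval (p.specX (p.q⁻¹ * u)) := by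
  have hadd := hp.specX_add u
  have hmul := hp.specX_mul hu
  have hw := hp.weight_add hu hb1 hb2
  have hw' := hp.weight_add_mul hu hb1 hb2
  set x := p.specX u
  set y := p.specX (p.q * u)
  set z := p.specX (p.q⁻¹ * u)
  set β := p.q ^ 2 + p.q ^ (-2 : ℤ) with hβ
  set D : ℕ → ℂ := fun k => (p.monomialImage k).eval x with hD
  have hrec : ∀ k, D (k + 2) = β * (x * D (k + 1)) - x * (x * D k) - p.ρ ^ 2 * D k
      + (p.q - p.q⁻¹) * p.η * x ^ (k + 1) - p.ρ * p.ηs * x ^ k := fun k => by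
    simp [D, monomialImage, β]
  have key : ∀ k : ℕ, D (k + 1) - x * D k = p.weightUp u * y ^ k + p.weightDown u * z ^ k := by
    have h0 : D 0 = p.θ 0 := by simp [D, monomialImage]
    have h1 : D 1 = p.θ 1 * x + p.ν := by simp [D, monomialImage]
    intro k
    induction k using Nat.twoStepInduction with
    | zero => linear_combination h1 - x * h0 - hw
    | one => linear_combination hrec 0 + (β * x - x) * h1 - (x ^ 2 + p.ρ ^ 2) * h0 - hw'
    | more k h1 h2 =>
      linear_combination hrec (k + 1) - x * hrec k + (y + z) * h2 - y * z * h1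
        - (D (k + 2) - x * D (k + 1)) * hadd + (D (k + 1) - x * D k) * hmul
  induction Q using Polynomial.induction_on' with
  | add P Q h1 h2 => rw [mul_add, map_add, eval_add, h1, h2, eval_add, eval_add]; ring
  | monomial k a =>
    rw [← C_mul_X_pow_eq_monomial, mul_left_comm, ← smul_eq_C_mul, map_smul, sub_mul, map_sub,
      ← pow_succ', ← smul_eq_C_mul, map_smul, diffOp_X_pow, diffOp_X_pow]
    simp only [eval_smul, eval_sub, smul_eq_mul, eval_mul, eval_C, eval_pow, eval_X]
    linear_combination a * key k

end Params

variable {V : Type*} [AddCommGroup V] [Module ℂ V] {p : Params} {A Y : End ℂ V}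

namespace IsXPair

/-- By the cubic relation, the vectors `A X^k Ω` satisfy the recursion that defines `D_k`. -/
theorem apply_aeval (h : IsXPair p A Y) {Ω : V} (hΩ : A Ω = p.θ 0 • Ω) (P : ℂ[X]) :
    A (aeval Y P Ω) = aeval Y (p.diffOp P) Ω := by
  have key : ∀ k : ℕ, A ((Y ^ k) Ω) = aeval Y (p.monomialImage k) Ω := by
    intro k
    induction k using Nat.twoStepInduction with
    | zero => simp [Params.monomialImage, hΩ, algebraMap_end_apply]
    | one => simp [Params.monomialImage, h.reference Ω hΩ, algebraMap_end_apply]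
    | more k h1 h2 =>
      have h3 := congrArg (fun f : End ℂ V => f ((Y ^ k) Ω)) h.cubic
      simp only [LinearMap.add_apply, LinearMap.sub_apply, LinearMap.smul_apply, Module.End.mul_apply,
        Module.End.one_apply] at h3
      have e1 : (Y ^ (k + 1)) Ω = Y ((Y ^ k) Ω) := by rw [pow_succ', Module.End.mul_apply]
      have e2 : (Y ^ (k + 2)) Ω = Y (Y ((Y ^ k) Ω)) := by
        rw [pow_succ', Module.End.mul_apply, e1]
      rw [e1] at h2
      rw [Params.monomialImage]
      generalize p.q ^ 2 + p.q ^ (-2 : ℤ) = β at *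
      generalize (p.q - p.q⁻¹) * p.η = e at *
      generalize p.ρ * p.ηs = g at *
      generalize p.ρ ^ 2 = r at *
      simp only [map_add, map_sub, map_mul, map_pow, aeval_X, aeval_C,
        LinearMap.add_apply, LinearMap.sub_apply, Module.End.mul_apply, Module.algebraMap_end_apply,
        ← h1, ← h2, e1, e2]
      rw [← sub_eq_zero] at h3 ⊢
      rw [← h3]
      module
  induction P using Polynomial.induction_on' with
  | add P Q h1 h2 => simp only [map_add, LinearMap.add_apply, h1, h2]
  | monomial k a =>
    rw [← C_mul_X_pow_eq_monomial, ← smul_eq_C_mul, map_smul, map_smul, map_smul,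
      Params.diffOp_X_pow, LinearMap.smul_apply, map_smul, LinearMap.smul_apply, ← key]
    simp

/-- Nonzero polynomials in `Y` of degree at most `n` do not annihilate the reference vector: the
vectors `P(Y) Ω` form an invariant subspace, so `Ω` is cyclic for `Y`. -/
theorem aeval_apply_ne_zero (h : IsXPair p A Y) {n : ℕ} (hn : finrank ℂ V = n + 1) {Ω : V}
    (hΩ0 : Ω ≠ 0) (hΩ : A Ω = p.θ 0 • Ω) {P : ℂ[X]} (hP : P.Monic) (hdeg : P.natDegree ≤ n) :
    aeval Y P Ω ≠ 0 := by
  intro h0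
  have hfin : FiniteDimensional ℂ V := Module.finite_of_finrank_pos (by omega)
  let ev : ℂ[X] →ₗ[ℂ] V := (LinearMap.applyₗ Ω) ∘ₗ (aeval Y).toLinearMap
  have hev : ∀ Q, ev Q = aeval Y Q Ω := fun Q => rfl
  have htop : LinearMap.range ev = ⊤ := by
    refine (h.irreducible _ ?_ ?_).resolve_left ?_
    · rintro _ ⟨Q, rfl⟩
      exact ⟨p.diffOp Q, by rw [hev, hev, h.apply_aeval hΩ]⟩
    · rintro _ ⟨Q, rfl⟩
      exact ⟨X * Q, by rw [hev, hev, map_mul, aeval_X, Module.End.mul_apply]⟩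
    · intro hbot
      have : ev 1 ∈ LinearMap.range ev := ⟨1, rfl⟩
      rw [hbot, Submodule.mem_bot, hev, map_one, Module.End.one_apply] at this
      exact hΩ0 this
  have hle : (⊤ : Submodule ℂ V) ≤ (degreeLT ℂ P.natDegree).map ev := by
    rw [← htop]
    rintro _ ⟨Q, rfl⟩
    refine ⟨Q %ₘ P, ?_, ?_⟩
    · rw [SetLike.mem_coe, mem_degreeLT, ← degree_eq_natDegree hP.ne_zero]
      exact degree_modByMonic_lt _ hP
    · conv_rhs => rw [← modByMonic_add_div Q P]
      rw [map_add, hev (P * _), mul_comm, map_mul, Module.End.mul_apply, h0, map_zero, add_zero]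
  have h1 := Submodule.finrank_mono hle
  have h2 := Submodule.finrank_map_le ev (degreeLT ℂ P.natDegree)
  rw [finrank_top, hn] at h1
  rw [(degreeLTEquiv ℂ _).finrank_eq, finrank_fin_fun] at h2
  omega

end IsXPair

end

/-! ### Bethe equations as an eigenvalue problem, and Bethe states as polynomials -/

section

namespace Params

variable {p : Params}

/-- The monic polynomial with the zeros `x(u_1), …, x(u_M)`. -/
def bethePoly (p : Params) {M : ℕ} (u : Fin M → ℂ) : ℂ[X] := ∏ i, (X - C (p.specX (u i)))

theorem monic_bethePoly (p : Params) {M : ℕ} (u : Fin M → ℂ) : (p.bethePoly u).Monic :=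
  monic_prod_X_sub_C _ _

theorem natDegree_bethePoly (p : Params) {M : ℕ} (u : Fin M → ℂ) :
    (p.bethePoly u).natDegree = M := by
  simp [bethePoly, natDegree_finsetProd_X_sub_C_eq_card]

theorem Valid.specX_factor_ne (hp : p.Valid) : -p.ρ / (p.q ^ 2 - (p.q ^ 2)⁻¹) ≠ 0 := by
  refine div_ne_zero (neg_ne_zero.2 hp.ρ_ne) ?_
  simpa [zpow_neg] using hp.sq_sub_ne

theorem Valid.specX_eq_symRoot (hp : p.Valid) (u : ℂ) :
    p.specX u = -p.ρ / (p.q ^ 2 - (p.q ^ 2)⁻¹) * (p.q + p.q⁻¹) * p.symRoot u := by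
  have := hp.sq_add_one_ne
  have hq := hp.q_ne
  simp only [specX, symRoot, zpow_neg]
  norm_cast
  field_simp

theorem Valid.specX_sub (hp : p.Valid) {u v : ℂ} (hu : u ≠ 0) (hv : v ≠ 0) :
    p.specX u - p.specX v = -p.ρ / (p.q ^ 2 - (p.q ^ 2)⁻¹) * (bf (p.q * u * v) * bf (u / v)) := by
  have hq := hp.q_ne
  simp only [specX, bf]
  field_simp
  ring

/-- The factors `f` and `h` of the Bethe equations are the ratios by which `x(u) - x(v)` changes under
`u ↦ q⁻¹ u` and `u ↦ q u`. -/
theorem Valid.f_mul (hp : p.Valid) {u v : ℂ} (hu : u ≠ 0) (hv : v ≠ 0)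
    (huv : p.specX u ≠ p.specX v) :
    p.f u v * (p.specX u - p.specX v) = p.specX (p.q⁻¹ * u) - p.specX v := by
  have hq := hp.q_ne
  have h1 := hp.specX_sub hv hu
  have h2 := hp.specX_sub hv (mul_ne_zero (inv_ne_zero hq) hu)
  rw [show p.q * v * (p.q⁻¹ * u) = u * v by field_simp,
    show v / (p.q⁻¹ * u) = p.q * v / u by field_simp] at h2
  rw [show p.q * v * u = p.q * u * v by ring] at h1
  have h3 : bf (v / u) * bf (p.q * u * v) ≠ 0 := by
    intro h
    rw [mul_comm (bf (p.q * u * v)), h, mul_zero] at h1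
    exact huv (sub_eq_zero.1 h1).symm
  rw [f, div_mul_eq_mul_div, div_eq_iff h3]
  linear_combination (-(bf (p.q * v / u) * bf (u * v))) * h1 + bf (v / u) * bf (p.q * u * v) * h2

theorem Valid.h_mul (hp : p.Valid) {u v : ℂ} (hu : u ≠ 0) (hv : v ≠ 0)
    (huv : p.specX u ≠ p.specX v) :
    p.h u v * (p.specX u - p.specX v) = p.specX (p.q * u) - p.specX v := by
  have hq := hp.q_ne
  have h1 := hp.specX_sub hu hv
  have h2 := hp.specX_sub (mul_ne_zero hq hu) hv
  rw [show p.q * (p.q * u) * v = p.q ^ 2 * u * v by ring] at h2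
  have h3 : bf (p.q * u * v) * bf (u / v) ≠ 0 := by
    intro h
    rw [h, mul_zero] at h1
    exact huv (sub_eq_zero.1 h1)
  rw [h, div_mul_eq_mul_div, div_eq_iff h3]
  linear_combination (bf (p.q ^ 2 * u * v) * bf (p.q * u / v)) * h1
    - bf (p.q * u * v) * bf (u / v) * h2

/-- The Bethe functions for `ε = 1` are, up to a nonzero factor, those for `ε = -1` with exchanged
parameters; this uses `b c = b* c*`. -/
theorem Valid.E_swap (hp : p.Valid) {M : ℕ} (u : Fin M → ℂ) (hu : ∀ i, u i ≠ 0) (i : Fin M) :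
    p.E 1 u i = (u i ^ 2)⁻¹ * p.swap.E (-1) u i := by
  have hq := hp.q_ne
  have hb := hp.b_ne
  have hc := hp.c_ne
  have hcs := hp.cs_ne
  have hζ := hp.ζ_ne
  have hi := hu i
  have hQ : p.q ^ p.n ≠ 0 := pow_ne_zero _ hq
  have hbs : p.bs = p.b * p.c / p.cs := by
    field_simp
    linear_combination -hp.bc_eq
  have h1 : p.Λ₁ 1 (u i) = (u i ^ 2)⁻¹ * p.swap.Λ₁ (-1) (u i) := by
    rw [hp.swap.Λ₁_eq]
    simp only [Λ₁, Params.swap, zpow_neg, zpow_sub₀ hq, zpow_one, zpow_natCast, pow_succ,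
      show (1 - 1 : ℤ) / 2 = 0 from rfl, show (1 + 1 : ℤ) / 2 = 1 from rfl, zpow_zero, hbs]
    generalize p.q ^ p.n = Q at *
    field_simp
  have h2 : p.Λ₂ 1 (u i) = (u i ^ 2)⁻¹ * p.swap.Λ₂ (-1) (u i) := by
    rw [hp.swap.Λ₂_eq]
    simp only [Λ₂, Params.swap, zpow_neg, zpow_sub₀ hq, zpow_one, zpow_natCast, bf, mul_inv,
      show (1 - 1 : ℤ) / 2 = 0 from rfl, show (1 + 1 : ℤ) / 2 = 1 from rfl, zpow_zero, hbs]
    norm_cast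
    simp only [pow_succ]
    generalize p.q ^ p.n = Q at *
    field_simp
  have h3 : ∀ v, p.swap.f (u i) v = p.f (u i) v := fun _ => rfl
  have h4 : ∀ v, p.swap.h (u i) v = p.h (u i) v := fun _ => rfl
  simp only [E, h1, h2, h3, h4]
  rw [show p.swap.q = p.q from rfl]
  ring

/-- The two families of Bethe equations are exchanged by `(b, c, ζ) ↔ (b*, c*, ζ⁻¹)`. -/
theorem IsBetheSolution.swap (hp : p.Valid) {M : ℕ} {u : Fin M → ℂ}
    (hu : p.IsBetheSolution 1 u) : p.swap.IsBetheSolution (-1) u where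
  ne_zero := hu.ne_zero
  nontrivial := hu.nontrivial
  defined := hu.defined
  admissible := hu.admissible
  bethe i := by
    have h := hu.bethe i
    rw [hp.E_swap u hu.ne_zero] at h
    exact (mul_eq_zero.1 h).resolve_left (inv_ne_zero (pow_ne_zero _ (hu.ne_zero i)))

theorem IsBetheSolution.bf_ne {ε : ℤ} {M : ℕ} {u : Fin M → ℂ} (hu : p.IsBetheSolution ε u)
    (i : Fin M) : bf (u i ^ 2) ≠ 0 := by
  have h := hu.nontrivial i
  rw [zpow_neg] at h
  rw [bf, sub_ne_zero]
  exact_mod_cast h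

/-- On a Bethe solution the polynomial `∏ (x - x(u_i))` is an eigenvector of the difference
operator: the Bethe equations say that its image vanishes at all `x(u_i)`. -/
theorem IsBetheSolution.diffOp_bethePoly (hp : p.Valid) {M : ℕ} {u : Fin M → ℂ}
    (hu : p.IsBetheSolution (-1) u) :
    p.diffOp (p.bethePoly u) = C (p.θ M) * p.bethePoly u := by
  have hinj : ∀ i j, i ≠ j → p.specX (u i) ≠ p.specX (u j) := by
    intro i j hij h
    rw [hp.specX_eq_symRoot, hp.specX_eq_symRoot] at h
    exact hu.admissible i j hij
      (mul_left_cancel₀ (mul_ne_zero hp.specX_factor_ne hp.add_inv_ne) h)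
  rw [← sub_eq_zero]
  refine eq_zero_of_degree_lt_of_eval_index_eq_zero (s := Finset.univ)
    (v := fun i => p.specX (u i)) ?_ ?_ ?_
  · intro i _ j _ hij
    by_contra h
    exact hinj i j h hij
  · simpa using degree_diffOp_sub_lt hp.q_ne (p.natDegree_bethePoly u)
  · intro i _
    have hsplit : p.bethePoly u
        = (X - C (p.specX (u i))) * ∏ j ∈ Finset.univ.erase i, (X - C (p.specX (u j))) :=
      (Finset.mul_prod_erase _ _ (Finset.mem_univ i)).symm
    have hf : ∏ j ∈ Finset.univ.erase i, (p.specX (p.q⁻¹ * u i) - p.specX (u j))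
        = (∏ j ∈ Finset.univ.erase i, p.f (u i) (u j))
          * ∏ j ∈ Finset.univ.erase i, (p.specX (u i) - p.specX (u j)) := by
      rw [← Finset.prod_mul_distrib]
      refine Finset.prod_congr rfl fun j hj => (hp.f_mul (hu.ne_zero i) (hu.ne_zero j) ?_).symm
      exact hinj i j (Finset.ne_of_mem_erase hj).symm
    have hh : ∏ j ∈ Finset.univ.erase i, (p.specX (p.q * u i) - p.specX (u j))
        = (∏ j ∈ Finset.univ.erase i, p.h (u i) (u j))
          * ∏ j ∈ Finset.univ.erase i, (p.specX (u i) - p.specX (u j)) := by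
      rw [← Finset.prod_mul_distrib]
      refine Finset.prod_congr rfl fun j hj => (hp.h_mul (hu.ne_zero i) (hu.ne_zero j) ?_).symm
      exact hinj i j (Finset.ne_of_mem_erase hj).symm
    have hE := hu.bethe i
    have hb1 := hu.bf_ne i
    rw [eval_sub, eval_C_mul, hsplit, hp.eval_diffOp (hu.ne_zero i) hb1 (hu.defined i)]
    simp only [eval_mul, eval_prod, eval_sub, eval_X, eval_C, sub_self, zero_mul, mul_zero, sub_zero]
    rw [hf, hh, weightUp, weightDown]
    rw [E] at hE
    rw [mul_inv, mul_inv]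
    have h1 : (bf (u i ^ 2))⁻¹ * bf (u i ^ 2) = 1 := inv_mul_cancel₀ hb1
    linear_combination p.b * p.c * (p.q ^ 2 - (p.q ^ 2)⁻¹) * (p.q - p.q⁻¹) * (u i)⁻¹
      * (∏ j ∈ Finset.univ.erase i, (p.specX (u i) - p.specX (u j)))
      * ((bf (u i ^ 2))⁻¹ * hE + (bf (p.q * u i ^ 2))⁻¹
        * (∏ j ∈ Finset.univ.erase i, p.f (u i) (u j)) * p.Λ₁ (-1) (u i) * h1)

end Params

variable {V : Type*} [AddCommGroup V] [Module ℂ V] {p : Params} {A As : End ℂ V}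

/-- On-shell Bethe states are eigenvectors of `A`. -/
theorem IsXPair.apply_bethePoly {Y : End ℂ V} (hp : p.Valid) (h : IsXPair p A Y) {Ω : V}
    (hΩ : A Ω = p.θ 0 • Ω) {M : ℕ} {u : Fin M → ℂ} (hu : p.IsBetheSolution (-1) u) :
    A (aeval Y (p.bethePoly u) Ω) = p.θ M • aeval Y (p.bethePoly u) Ω := by
  rw [h.apply_aeval hΩ, hu.diffOp_bethePoly hp, ← smul_eq_C_mul, map_smul, LinearMap.smul_apply]

theorem K₁₂_eq (hp : p.Valid) (u : ℂ) :
    K₁₂ p A As u = (p.χ * bf (u ^ 2) * p.ρ⁻¹) •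
      aeval (shiftedComm p A As) (X - C (p.specX u)) := by
  have hρ := hp.ρ_ne
  rw [map_sub, aeval_X, aeval_C, Algebra.algebraMap_eq_smul_one]
  simp only [K₁₂, shiftedComm, Params.specX, zpow_neg]
  norm_cast
  match_scalars
  · ring
  · field_simp
    ring

/-- The scalar relating `ℬ^ε(u, m)` with `β = 0` and, up to sign, `𝒞^ε(u, m)` with `α = 0` to a linear
polynomial in the shifted `q`-commutator; `γ` stands for the value of `γ^ε` in their denominators. -/
def dynScalar (p : Params) (ε : ℤ) (γ u : ℂ) : ℂ :=
  -(ε : ℂ) * (p.q * u) ^ (-ε) / γ * (p.χ * bf (u ^ 2) * p.ρ⁻¹)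

theorem dynB_eq (hp : p.Valid) (ε : ℤ) (α u : ℂ) (m : ℤ) :
    dynB p A As ε α 0 u m = dynScalar p ε (gammaFn p ε α 0 1 (m + 1)) u •
      aeval (shiftedComm p A As) (X - C (p.specX u)) := by
  simp only [dynB, K₁₂_eq hp, dynScalar, zero_mul, zero_smul, add_zero, sub_zero, ne_eq,
    OfNat.ofNat_ne_zero, not_false_eq_true, zero_pow, smul_smul]

theorem dynC_eq (hp : p.Valid) (ε : ℤ) (β u : ℂ) (m : ℤ) :
    dynC p A As ε 0 β u m = -dynScalar p ε (gammaFn p ε 0 β 1 (m - 1)) u •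
      aeval (shiftedComm p A As) (X - C (p.specX u)) := by
  simp only [dynC, K₁₂_eq hp, dynScalar, zero_mul, zero_smul, add_zero, sub_zero, ne_eq,
    OfNat.ofNat_ne_zero, not_false_eq_true, zero_pow, smul_smul]
  congr 1
  ring

theorem prod_ofFn_smul_aeval (Y : End ℂ V) {M : ℕ} (u : Fin M → ℂ) (s : Fin M → ℂ) :
    (List.ofFn fun i => s i • aeval Y (X - C (p.specX (u i)))).prod
      = (∏ i, s i) • aeval Y (p.bethePoly u) := by
  have h : (fun i => s i • aeval Y (X - C (p.specX (u i))))
      = aeval Y ∘ fun i => s i • (X - C (p.specX (u i))) := by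
    funext i
    simp
  rw [h, ← List.map_ofFn, ← map_list_prod, List.prod_ofFn]
  simp only [smul_eq_C_mul]
  rw [Finset.prod_mul_distrib, ← map_prod, ← smul_eq_C_mul, map_smul]
  rfl

theorem stringB_eq (hp : p.Valid) (ε : ℤ) (α : ℂ) (m : ℤ) {M : ℕ} (u : Fin M → ℂ) :
    stringB p A As ε α 0 m u
      = (∏ i : Fin M, dynScalar p ε
          (gammaFn p ε α 0 1 (m + 2 * ((M : ℤ) - 1 - ((i : ℕ) : ℤ)) + 1)) (u i)) •
        aeval (shiftedComm p A As) (p.bethePoly u) := by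
  simp only [stringB, dynB_eq hp]
  exact prod_ofFn_smul_aeval _ u _

theorem stringC_eq (hp : p.Valid) (ε : ℤ) (β : ℂ) (m : ℤ) {M : ℕ} (u : Fin M → ℂ) :
    stringC p A As ε 0 β m u
      = (∏ i : Fin M, -dynScalar p ε (gammaFn p ε 0 β 1 (m + 2 * (((i : ℕ) : ℤ) + 1) - 1)) (u i)) •
        aeval (shiftedComm p A As) (p.bethePoly u) := by
  simp only [stringC, dynC_eq hp]
  exact prod_ofFn_smul_aeval _ u _

theorem dynScalar_ne_zero (hp : p.Valid) {ε : ℤ} (hε : ε ≠ 0) {γ u : ℂ} (hγ : γ ≠ 0) (hu : u ≠ 0)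
    (hbf : bf (u ^ 2) ≠ 0) : dynScalar p ε γ u ≠ 0 := by
  have h1 : (ε : ℂ) ≠ 0 := by exact_mod_cast hε
  have h2 : (p.q * u) ^ (-ε) ≠ 0 := zpow_ne_zero _ (mul_ne_zero hp.q_ne hu)
  exact mul_ne_zero (div_ne_zero (mul_ne_zero (neg_ne_zero.2 h1) h2) hγ)
    (mul_ne_zero (mul_ne_zero hp.χ_ne hbf) (inv_ne_zero hp.ρ_ne))

theorem gammaFn_neg_one (p : Params) (α : ℂ) (m : ℤ) :
    gammaFn p (-1) α 0 1 m = α * p.q ^ (-m) := by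
  simp [gammaFn]

theorem gammaFn_one (p : Params) (α : ℂ) (m : ℤ) : gammaFn p 1 α 0 1 m = -(α * p.q ^ m) := by
  simp [gammaFn]

theorem gammaFn_one_zero (p : Params) (β : ℂ) (m : ℤ) :
    gammaFn p 1 0 β 1 m = β * p.q ^ (-m) := by
  simp [gammaFn]

end

/-! ### The split basis -/

section

namespace Params

variable {p : Params}

theorem θs_add_two (p : Params) (hq : p.q ≠ 0) (k : ℕ) :
    p.θs (k + 2) = (p.q ^ 2 + p.q ^ (-2 : ℤ)) * p.θs (k + 1) - p.θs k :=
  p.swap.θ_add_two hq k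

theorem Valid.swap_κ_eq (hp : p.Valid) :
    p.swap.κ = p.splitCoeff 1 - p.θ 0 * (p.θs 1 - p.θs 0) := by
  rw [hp.swap.κ_eq, splitCoeff_swap]
  rfl

/-- The second-order recursion for the split sequence, forced by the Askey-Wilson relation. -/
theorem Valid.splitCoeff_step (hp : p.Valid) (k : ℕ) :
    p.splitCoeff (p.q ^ (2 * (k + 1))) =
      -p.θs k * (p.θ (k + 1) + p.θ k) - p.splitCoeff (p.q ^ (2 * k) * (p.q ^ 2)⁻¹)
      + (p.q ^ 2 + p.q ^ (-2 : ℤ)) * (p.θs (k + 1) * p.θ (k + 1) + p.splitCoeff (p.q ^ (2 * k))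
        + p.θ k * p.θs k) - (p.θ (k + 1) + p.θ k) * p.θs (k + 1) + p.ω := by
  have hq := hp.q_ne
  have hb := hp.b_ne
  have hc := hp.c_ne
  have hbs := hp.bs_ne
  have hζ := hp.ζ_ne
  have hQ : p.q ^ p.n ≠ 0 := pow_ne_zero _ hq
  have hy : p.q ^ (2 * k) ≠ 0 := pow_ne_zero _ hq
  rw [hp.ω_eq]
  simp only [θ_eq, θs_eq, splitCoeff, mul_add, pow_add, mul_one, hp.cs_eq, zpow_neg]
  norm_cast
  generalize p.q ^ p.n = Q at *
  generalize p.q ^ (2 * k) = y at *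
  field_simp
  ring

/-- The coefficient at the `k`-th split vector in the first Askey-Wilson relation, applied to that
vector. -/
theorem Valid.splitCoeff_relation (hp : p.Valid) (k : ℕ) :
    p.θs k * p.θ k ^ 2 + p.splitCoeff (p.q ^ (2 * k) * (p.q ^ 2)⁻¹) *
        (p.θ k + (p.b * (p.q ^ (2 * k) * (p.q ^ 2)⁻¹) + p.c * (p.q ^ (2 * k) * (p.q ^ 2)⁻¹)⁻¹))
      - (p.q ^ 2 + p.q ^ (-2 : ℤ)) * ((p.splitCoeff (p.q ^ (2 * k)) + p.θ k * p.θs k) * p.θ k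
        + p.θ k * p.splitCoeff (p.q ^ (2 * k) * (p.q ^ 2)⁻¹))
      + (p.θ (k + 1) + p.θ k) * p.splitCoeff (p.q ^ (2 * k)) + p.θ k ^ 2 * p.θs k
      = p.ρ * p.θs k + p.ω * p.θ k + p.η := by
  have hq := hp.q_ne
  have hb := hp.b_ne
  have hc := hp.c_ne
  have hbs := hp.bs_ne
  have hζ := hp.ζ_ne
  have hs := hp.sq_add_one_ne
  have hQ : p.q ^ p.n ≠ 0 := pow_ne_zero _ hq
  have hy : p.q ^ (2 * k) ≠ 0 := pow_ne_zero _ hq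
  rw [hp.ω_eq, hp.η_eq]
  simp only [θ_eq, θs_eq, ρ_eq, splitCoeff, mul_add, pow_add, mul_one, hp.cs_eq, zpow_neg]
  norm_cast
  generalize p.q ^ p.n = Q at *
  generalize p.q ^ (2 * k) = y at *
  field_simp
  ring

theorem Valid.θ_quadratic (hp : p.Valid) (k : ℕ) :
    (p.b * (p.q ^ (2 * k) * (p.q ^ 2)⁻¹) + p.c * (p.q ^ (2 * k) * (p.q ^ 2)⁻¹)⁻¹) ^ 2
      - (p.q ^ 2 + p.q ^ (-2 : ℤ)) * (p.θ k *
        (p.b * (p.q ^ (2 * k) * (p.q ^ 2)⁻¹) + p.c * (p.q ^ (2 * k) * (p.q ^ 2)⁻¹)⁻¹))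
      + p.θ k ^ 2 = p.ρ := by
  have hq := hp.q_ne
  have hy : p.q ^ (2 * k) ≠ 0 := pow_ne_zero _ hq
  simp only [θ_eq, ρ_eq, zpow_neg]
  norm_cast
  field_simp
  ring

theorem Valid.splitCoeff_neg (hp : p.Valid) : p.splitCoeff (p.q ^ (2 * 0) * (p.q ^ 2)⁻¹) = 0 := by
  have hq := hp.q_ne
  simp [splitCoeff, hq]

end Params

variable {W : Type*} [AddCommGroup W] [Module ℂ W] {p : Params} {a s : End ℂ W}

/-- The vectors `(a - θ_{k-1}) ⋯ (a - θ_0) Ω`. -/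
def splitVec (p : Params) (a : End ℂ W) (Ω : W) : ℕ → W
  | 0 => Ω
  | k + 1 => a (splitVec p a Ω k) - p.θ k • splitVec p a Ω k

theorem apply_splitVec (p : Params) (a : End ℂ W) (Ω : W) (k : ℕ) :
    a (splitVec p a Ω k) = splitVec p a Ω (k + 1) + p.θ k • splitVec p a Ω k := by
  rw [splitVec]; abel

theorem splitVec_eq_aeval (p : Params) (a : End ℂ W) (Ω : W) (k : ℕ) :
    splitVec p a Ω k = aeval a (∏ j ∈ Finset.range k, (X - C (p.θ j))) Ω := by
  induction k with
  | zero => simp [splitVec]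
  | succ k ih =>
    rw [Finset.prod_range_succ, mul_comm, map_mul, Module.End.mul_apply, ← ih]
    simp [splitVec]

theorem IsAWPair.splitVec_eq_zero (h : IsAWPair p a s) (Ω : W) {k : ℕ} (hk : p.n < k) :
    splitVec p a Ω k = 0 := by
  induction k, hk using Nat.le_induction with
  | base => rw [splitVec_eq_aeval, h.aeval_prod_eq_zero, LinearMap.zero_apply]
  | succ k _ ih => rw [splitVec, ih, map_zero, smul_zero, sub_zero]

/-- The inductive step for the bidiagonal action of `s`: `f, f₁, f₂` are consecutive split vectors and
`g` is the contribution of the preceding one to `s f`. -/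
theorem IsAWPair.splitVec_step (hp : p.Valid) (h : IsAWPair p a s) {k : ℕ} {f f₁ f₂ g : W}
    (hf : a f = f₁ + p.θ k • f) (hf₁ : a f₁ = f₂ + p.θ (k + 1) • f₁)
    (hg : a g = p.splitCoeff (p.q ^ (2 * k) * (p.q ^ 2)⁻¹) • f
      + (p.b * (p.q ^ (2 * k) * (p.q ^ 2)⁻¹) + p.c * (p.q ^ (2 * k) * (p.q ^ 2)⁻¹)⁻¹) • g)
    (hsf : s f = p.θs k • f + g)
    (hsf₁ : s f₁ = p.θs (k + 1) • f₁ + p.splitCoeff (p.q ^ (2 * k)) • f) :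
    s f₂ = p.θs (k + 2) • f₂ + p.splitCoeff (p.q ^ (2 * (k + 1))) • f₁ := by
  have h1 := congrArg (fun x : End ℂ W => x f) h.aw₁
  simp only [qComm_qComm hp.q_ne, LinearMap.add_apply, LinearMap.sub_apply, LinearMap.smul_apply,
    Module.End.mul_apply, Module.End.one_apply, hf, hsf, map_add, map_smul, hg, hsf₁, hf₁] at h1
  rw [p.θs_add_two hp.q_ne, hp.splitCoeff_step]
  have h2 := hp.splitCoeff_relation k
  have h3 := hp.θ_quadratic k
  rw [← sub_eq_zero] at h1 ⊢
  rw [← h1]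
  match_scalars
  · ring
  · ring
  · ring
  · linear_combination -h2
  · linear_combination -h3

/-- The operator `s` acts on the split vectors by an upper bidiagonal matrix. -/
theorem IsAWPair.apply_splitVec_succ (hp : p.Valid) (h : IsAWPair p a s) {Ω : W}
    (hΩ : s Ω = p.θs 0 • Ω) (k : ℕ) :
    s (splitVec p a Ω (k + 1)) = p.θs (k + 1) • splitVec p a Ω (k + 1)
      + p.splitCoeff (p.q ^ (2 * k)) • splitVec p a Ω k := by
  have h0 : s (splitVec p a Ω 1) = p.θs 1 • splitVec p a Ω 1
      + p.splitCoeff (p.q ^ (2 * 0)) • splitVec p a Ω 0 := by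
    have h1 := (h.swap hp).apply_apply_reference hp.swap hΩ
    rw [hp.swap_κ_eq] at h1
    simp only [splitVec, map_sub, map_smul, h1, hΩ, mul_zero, pow_zero,
      show p.swap.θ 1 = p.θs 1 from rfl]
    module
  induction k using Nat.twoStepInduction with
  | zero => exact h0
  | one =>
    refine h.splitVec_step hp (k := 0) (f := splitVec p a Ω 0) (f₁ := splitVec p a Ω 1) (g := 0)
      (apply_splitVec p a Ω 0) (apply_splitVec p a Ω 1) ?_ ?_ h0
    · rw [hp.splitCoeff_neg]; simp
    · simpa [splitVec] using hΩ
  | more k ih1 ih2 =>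
    have hq : p.q ^ (2 * (k + 1)) * (p.q ^ 2)⁻¹ = p.q ^ (2 * k) := by
      have := hp.q_ne
      rw [mul_add, pow_add]
      field_simp
    refine h.splitVec_step hp (k := k + 1) (f := splitVec p a Ω (k + 1))
      (g := p.splitCoeff (p.q ^ (2 * k)) • splitVec p a Ω k)
      (apply_splitVec p a Ω _) (apply_splitVec p a Ω _) ?_ ih1 ih2
    rw [hq, map_smul, apply_splitVec, p.θ_eq]
    module

theorem IsAWPair.span_splitVec (hp : p.Valid) (h : IsAWPair p a s) {Ω : W} (hΩ0 : Ω ≠ 0)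
    (hΩ : s Ω = p.θs 0 • Ω) :
    Submodule.span ℂ (Set.range fun k : Fin (p.n + 1) => splitVec p a Ω k) = ⊤ := by
  set S := Submodule.span ℂ (Set.range fun k : Fin (p.n + 1) => splitVec p a Ω k)
  have hmem : ∀ k, splitVec p a Ω k ∈ S := by
    intro k
    rcases lt_or_ge k (p.n + 1) with hk | hk
    · exact Submodule.subset_span ⟨⟨k, hk⟩, rfl⟩
    · rw [h.splitVec_eq_zero Ω (by omega)]; exact S.zero_mem
  have hinv : ∀ f : End ℂ W, (∀ k, f (splitVec p a Ω k) ∈ S) → ∀ x ∈ S, f x ∈ S := by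
    intro f hf x hx
    have : S ≤ S.comap f := Submodule.span_le.2 (by rintro _ ⟨k, rfl⟩; exact hf k)
    exact this hx
  refine (h.irreducible S (hinv a fun k => ?_) (hinv s fun k => ?_)).resolve_left ?_
  · rw [apply_splitVec]
    exact S.add_mem (hmem _) (S.smul_mem _ (hmem _))
  · cases k with
    | zero => rw [splitVec, hΩ]; exact S.smul_mem _ (hmem 0)
    | succ k =>
      rw [h.apply_splitVec_succ hp hΩ]
      exact S.add_mem (S.smul_mem _ (hmem _)) (S.smul_mem _ (hmem _))
  · intro hbot
    have := hmem 0
    rw [hbot, Submodule.mem_bot] at this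
    exact hΩ0 this

theorem IsAWPair.linearIndependent_splitVec (hp : p.Valid) (h : IsAWPair p a s) {Ω : W}
    (hΩ0 : Ω ≠ 0) (hΩ : s Ω = p.θs 0 • Ω) :
    LinearIndependent ℂ fun k : Fin (p.n + 1) => splitVec p a Ω k :=
  linearIndependent_of_top_le_span_of_card_eq_finrank (h.span_splitVec hp hΩ0 hΩ).ge
    (by rw [Fintype.card_fin, h.finrank_eq])

/-- The split sequence does not vanish: otherwise the split vectors of large index would span a
proper invariant subspace. -/
theorem IsAWPair.splitCoeff_ne_zero (hp : p.Valid) (h : IsAWPair p a s) {Ω : W} (hΩ0 : Ω ≠ 0)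
    (hΩ : s Ω = p.θs 0 • Ω) {k : ℕ} (hk : k < p.n) : p.splitCoeff (p.q ^ (2 * k)) ≠ 0 := by
  intro h0
  have hli := h.linearIndependent_splitVec hp hΩ0 hΩ
  set I : Set (Fin (p.n + 1)) := {j | k < j} with hI
  set S := Submodule.span ℂ ((fun j : Fin (p.n + 1) => splitVec p a Ω j) '' I)
  have hmem : ∀ j, k < j → splitVec p a Ω j ∈ S := by
    intro j hkj
    rcases lt_or_ge j (p.n + 1) with hj | hj
    · exact Submodule.subset_span ⟨⟨j, hj⟩, hkj, rfl⟩
    · rw [h.splitVec_eq_zero Ω (by omega)]; exact S.zero_mem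
  have hinv : ∀ f : End ℂ W, (∀ j, k < j → f (splitVec p a Ω j) ∈ S) → ∀ x ∈ S, f x ∈ S := by
    intro f hf x hx
    have : S ≤ S.comap f := Submodule.span_le.2 (by rintro _ ⟨j, hj, rfl⟩; exact hf j hj)
    exact this hx
  have hcases := h.irreducible S (hinv a fun j hj => ?_) (hinv s fun j hj => ?_)
  · rcases hcases with hbot | htop
    · have h1 := hmem (k + 1) (by omega)
      rw [hbot, Submodule.mem_bot] at h1
      exact hli.ne_zero ⟨k + 1, by omega⟩ h1
    · have h1 : splitVec p a Ω ((0 : Fin (p.n + 1)) : ℕ) ∈ S := by rw [htop]; trivial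
      exact hli.notMem_span_image (s := I) (by simp [I]) h1
  · rw [apply_splitVec]
    exact S.add_mem (hmem _ (by omega)) (S.smul_mem _ (hmem _ hj))
  · obtain ⟨j, rfl⟩ : ∃ i, j = i + 1 := Nat.exists_eq_add_of_le' (by omega)
    rw [h.apply_splitVec_succ hp hΩ]
    refine S.add_mem (S.smul_mem _ (hmem _ hj)) ?_
    rcases (Nat.lt_succ_iff.1 hj).eq_or_lt with rfl | hj'
    · rw [h0, zero_smul]; exact S.zero_mem
    · exact S.smul_mem _ (hmem _ hj')

end

/-! ### Eigenvectors in the split basis and their three-term relation -/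

section

namespace Params

variable {p : Params}

/-- The polynomial `∏_{i<j} (θ* - θ*_i)` in `θ* = b* σ + c* σ⁻¹`, as a function of `σ`. -/
def nodeProd (p : Params) (j : ℕ) (σ : ℂ) : ℂ :=
  ∏ i ∈ Finset.range j, (p.bs * σ + p.cs * σ⁻¹ - p.θs i)

theorem nodeProd_succ (p : Params) (hq : p.q ≠ 0) (j : ℕ) {σ : ℂ} (hσ : σ ≠ 0) :
    p.nodeProd (j + 1) σ = p.nodeProd j σ *
      ((σ - p.q ^ (2 * j)) * (p.bs - p.cs * (p.q ^ (2 * j))⁻¹ * σ⁻¹)) := by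
  rw [nodeProd, Finset.prod_range_succ, ← nodeProd, θs_eq]
  have hy : p.q ^ (2 * j) ≠ 0 := pow_ne_zero _ hq
  congr 1
  field_simp
  ring

/-- Under `σ ↦ q² σ` all but the boundary factors of `∏_{i≤j} (θ* - θ*_i)` move to neighbouring ones, so
the shifted product is a multiple of the original one. -/
theorem nodeProd_shift_up (p : Params) (hq : p.q ≠ 0) (j : ℕ) {σ : ℂ} (hσ : σ ≠ 0) :
    (p.bs - p.cs * σ⁻¹) * p.nodeProd (j + 1) (σ * p.q ^ 2) = p.nodeProd j σ *
      ((p.bs - p.cs * (p.q ^ (2 * j))⁻¹ * σ⁻¹) * p.q ^ (2 * j) * (p.q ^ 2 * σ - 1)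
        * (p.bs - p.cs * (p.q ^ (2 * j))⁻¹ * (σ * p.q ^ 2)⁻¹)) := by
  have hσ' : σ * p.q ^ 2 ≠ 0 := mul_ne_zero hσ (pow_ne_zero _ hq)
  induction j with
  | zero =>
    rw [nodeProd_succ p hq _ hσ']
    simp only [nodeProd, Finset.range_zero, Finset.prod_empty, mul_zero, pow_zero]
    ring
  | succ j ih =>
    rw [nodeProd_succ p hq _ hσ', ← mul_assoc, ih, nodeProd_succ p hq j hσ, mul_add, pow_add, mul_one]
    have hy : p.q ^ (2 * j) ≠ 0 := pow_ne_zero _ hq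
    generalize p.q ^ (2 * j) = y at *
    field_simp

/-- The analogue of `nodeProd_shift_up` for `σ ↦ q⁻² σ`. -/
theorem nodeProd_shift_down (p : Params) (hq : p.q ≠ 0) (j : ℕ) {σ : ℂ} (hσ : σ ≠ 0) :
    (σ - 1) * p.nodeProd (j + 1) (σ * (p.q ^ 2)⁻¹) = p.nodeProd j σ *
      ((σ - p.q ^ (2 * j)) * (p.q ^ (2 * j))⁻¹ * (σ * (p.q ^ 2)⁻¹ - p.q ^ (2 * j))
        * (p.bs - p.cs * p.q ^ 2 * σ⁻¹)) := by
  have hσ' : σ * (p.q ^ 2)⁻¹ ≠ 0 := mul_ne_zero hσ (inv_ne_zero (pow_ne_zero _ hq))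
  induction j with
  | zero =>
    rw [nodeProd_succ p hq _ hσ']
    simp only [nodeProd, Finset.range_zero, Finset.prod_empty, mul_zero, pow_zero, mul_inv, inv_inv]
    ring
  | succ j ih =>
    rw [nodeProd_succ p hq _ hσ', ← mul_assoc, ih, nodeProd_succ p hq j hσ, mul_add, pow_add, mul_one]
    have hy : p.q ^ (2 * j) ≠ 0 := pow_ne_zero _ hq
    generalize p.q ^ (2 * j) = y at *
    field_simp

/-- The coefficient `A_{N,N-1}` as a function of `σ = q^{2N}`. -/
def lowerCoeff (p : Params) (σ : ℂ) : ℂ :=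
  p.q ^ 2 * ((p.q ^ p.n) ^ 2)⁻¹ * ((1 - σ) * (p.cs - p.bs * σ * (p.q ^ p.n) ^ 2)
      * (p.b * p.q ^ p.n * p.q⁻¹ * p.ζ ^ 2 + p.bs * σ * (p.q ^ 2)⁻¹)
      * (p.cs * p.q ^ p.n * p.q⁻¹ * (p.ζ ^ 2)⁻¹ + p.c * σ * (p.q ^ 2)⁻¹))
    / ((p.cs - p.bs * (σ ^ 2 * (p.q ^ 2)⁻¹)) * (p.cs - p.bs * σ ^ 2))

/-- The coefficient `A_{N,N+1}` as a function of `σ = q^{2N}`. -/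
def upperCoeff (p : Params) (σ : ℂ) : ℂ :=
  p.c * p.cs * ((1 + p.b / p.cs * (p.q ^ p.n * p.q * σ) * p.ζ ^ 2)
      * (1 + p.bs / p.c * (p.q ^ p.n * p.q * σ) * (p.ζ ^ 2)⁻¹)
      * (1 - σ * ((p.q ^ p.n) ^ 2)⁻¹) * (p.cs - p.bs * σ))
    / ((p.cs - p.bs * σ ^ 2) * (p.cs - p.bs * (σ ^ 2 * p.q ^ 2)))

theorem Valid.lowerCoeff_eq_ASub (hp : p.Valid) (N : ℕ) :
    p.lowerCoeff (p.q ^ (2 * N)) = p.ASub N := by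
  have hq := hp.q_ne
  have h1 : p.q ^ (2 - 2 * (p.n : ℤ)) = p.q ^ 2 * ((p.q ^ p.n) ^ 2)⁻¹ := by
    rw [zpow_sub₀ hq, div_eq_mul_inv, ← pow_mul, mul_comm p.n]; norm_cast
  have h2 : p.q ^ ((p.n : ℤ) - 1) = p.q ^ p.n * p.q⁻¹ := by
    rw [zpow_sub₀ hq, div_eq_mul_inv, zpow_one]; norm_cast
  have h3 : p.q ^ (2 * (N : ℤ) - 2) = p.q ^ (2 * N) * (p.q ^ 2)⁻¹ := by
    rw [zpow_sub₀ hq, div_eq_mul_inv]; norm_cast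
  have h4 : p.q ^ (4 * (N : ℤ) - 2) = (p.q ^ (2 * N)) ^ 2 * (p.q ^ 2)⁻¹ := by
    rw [zpow_sub₀ hq, div_eq_mul_inv, ← pow_mul, show 2 * N * 2 = 4 * N by ring]; norm_cast
  have h5 : p.q ^ (4 * (N : ℤ)) = (p.q ^ (2 * N)) ^ 2 := by
    rw [← pow_mul, show 2 * N * 2 = 4 * N by ring]; norm_cast
  have h6 : p.ζ⁻¹ ^ (-2 : ℤ) = p.ζ ^ 2 := by simp
  simp only [ASub, AsSub, Params.swap, lowerCoeff, h1, h2, h3, h4, h5, h6, inv_pow, pow_add,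
    show 2 * p.n = p.n * 2 from mul_comm _ _, pow_mul p.q p.n]
  ring

/-- The denominators of the three-term relation are nonzero by genericity. -/
theorem Valid.den_ne (hp : p.Valid) {k : ℤ} (h1 : -1 ≤ k) (h2 : k ≤ 2 * p.n + 1) {x : ℂ}
    (hx : x = p.q ^ (2 * k)) : p.cs - p.bs * x ≠ 0 := by
  rw [hx, sub_ne_zero]
  exact hp.generic_star k h1 h2

/-- The scalar form of the three-term relation for the eigencovectors. -/
theorem Valid.nodeProd_three_term (hp : p.Valid) (j : ℕ) {σ : ℂ} (hσ : σ ≠ 0)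
    (h1 : p.cs - p.bs * (σ ^ 2 * (p.q ^ 2)⁻¹) ≠ 0) (h2 : p.cs - p.bs * σ ^ 2 ≠ 0)
    (h3 : p.cs - p.bs * (σ ^ 2 * p.q ^ 2) ≠ 0) :
    p.nodeProd j σ * p.splitCoeff (p.q ^ (2 * j))
      + (p.θ (j + 1) - p.θ 0) * p.nodeProd (j + 1) σ
      = p.lowerCoeff σ * (p.nodeProd (j + 1) (σ * (p.q ^ 2)⁻¹) - p.nodeProd (j + 1) σ)
        + p.upperCoeff σ * (p.nodeProd (j + 1) (σ * p.q ^ 2) - p.nodeProd (j + 1) σ) := by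
  have hq := hp.q_ne
  have hb := hp.b_ne
  have hc := hp.c_ne
  have hcs := hp.cs_ne
  have hζ := hp.ζ_ne
  have hQ : p.q ^ p.n ≠ 0 := pow_ne_zero _ hq
  have hy : p.q ^ (2 * j) ≠ 0 := pow_ne_zero _ hq
  have hbs := hp.bs_ne
  have hc' : p.c = p.bs * p.cs / p.b := by
    field_simp
    linear_combination hp.bc_eq
  -- The factors `σ - 1` of the lower and `b* - c* σ⁻¹` of the upper coefficient are split off, since
  -- only together with them the shifted products are multiples of `nodeProd j σ`.
  obtain ⟨D, hD⟩ : ∃ D, D = p.q ^ 2 * ((p.q ^ p.n) ^ 2)⁻¹ * (-(p.cs - p.bs * σ * (p.q ^ p.n) ^ 2)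
      * (p.b * p.q ^ p.n * p.q⁻¹ * p.ζ ^ 2 + p.bs * σ * (p.q ^ 2)⁻¹)
      * (p.cs * p.q ^ p.n * p.q⁻¹ * (p.ζ ^ 2)⁻¹ + p.c * σ * (p.q ^ 2)⁻¹))
    / ((p.cs - p.bs * (σ ^ 2 * (p.q ^ 2)⁻¹)) * (p.cs - p.bs * σ ^ 2)) := ⟨_, rfl⟩
  obtain ⟨B, hB⟩ : ∃ B, B =  p.c * p.cs * ((1 + p.b / p.cs * (p.q ^ p.n * p.q * σ) * p.ζ ^ 2)
      * (1 + p.bs / p.c * (p.q ^ p.n * p.q * σ) * (p.ζ ^ 2)⁻¹)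
      * (1 - σ * ((p.q ^ p.n) ^ 2)⁻¹) * (-σ))
    / ((p.cs - p.bs * σ ^ 2) * (p.cs - p.bs * (σ ^ 2 * p.q ^ 2))) := ⟨_, rfl⟩
  have hlow : p.lowerCoeff σ = (σ - 1) * D := by
    rw [hD, lowerCoeff]; ring
  have hup : p.upperCoeff σ = (p.bs - p.cs * σ⁻¹) * B := by
    rw [hB, upperCoeff, show p.cs - p.bs * σ = (p.bs - p.cs * σ⁻¹) * (-σ) by field_simp; ring]
    ring
  have hT1 := p.nodeProd_succ hq j hσ
  have hT2 := p.nodeProd_shift_up hq j hσ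
  have hT3 := p.nodeProd_shift_down hq j hσ
  have key : p.splitCoeff (p.q ^ (2 * j)) + (p.θ (j + 1) - p.θ 0) *
      ((σ - p.q ^ (2 * j)) * (p.bs - p.cs * (p.q ^ (2 * j))⁻¹ * σ⁻¹))
      = D * (((σ - p.q ^ (2 * j)) * (p.q ^ (2 * j))⁻¹ * (σ * (p.q ^ 2)⁻¹ - p.q ^ (2 * j))
          * (p.bs - p.cs * p.q ^ 2 * σ⁻¹)) - (σ - 1) *
          ((σ - p.q ^ (2 * j)) * (p.bs - p.cs * (p.q ^ (2 * j))⁻¹ * σ⁻¹)))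
        + B * (((p.bs - p.cs * (p.q ^ (2 * j))⁻¹ * σ⁻¹) * p.q ^ (2 * j) * (p.q ^ 2 * σ - 1)
        * (p.bs - p.cs * (p.q ^ (2 * j))⁻¹ * (σ * p.q ^ 2)⁻¹)) - (p.bs - p.cs * σ⁻¹) *
          ((σ - p.q ^ (2 * j)) * (p.bs - p.cs * (p.q ^ (2 * j))⁻¹ * σ⁻¹))) := by
    have h1' : p.cs * p.q ^ 2 - p.bs * σ ^ 2 ≠ 0 := by
      intro h
      apply h1
      field_simp
      linear_combination h
    have h3' : p.cs - p.bs * p.q ^ 2 * σ ^ 2 ≠ 0 := by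
      rwa [mul_assoc, mul_comm (p.q ^ 2)]
    rw [hD, hB]
    simp only [splitCoeff, θ_eq, mul_zero, pow_zero, inv_one, mul_one, mul_add, pow_add, hc']
    clear hD hB hlow hup hT1 hT2 hT3
    generalize p.q ^ p.n = Q at *
    generalize p.q ^ (2 * j) = y at *
    field_simp
    ring
  rw [hlow, hup]
  linear_combination p.nodeProd j σ * key - D * hT3 - B * hT2
    + (p.θ (j + 1) - p.θ 0 + (σ - 1) * D + (p.bs - p.cs * σ⁻¹) * B) * hT1

end Params

variable {W : Type*} [AddCommGroup W] [Module ℂ W] {p : Params} {a s : End ℂ W}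

/-- The coefficients of the eigenvectors of `s` in the split basis. -/
def racahCoeff (p : Params) (σ : ℂ) (j : ℕ) : ℂ :=
  p.nodeProd j σ / ∏ i ∈ Finset.range j, p.splitCoeff (p.q ^ (2 * i))

/-- The vector that is an eigenvector of `s` for `θ*_N` when `σ = q^{2N}`, normalized to have
coefficient `1` at `Ω` in the split basis. -/
def racahVec (p : Params) (a : End ℂ W) (Ω : W) (σ : ℂ) : W :=
  ∑ j ∈ Finset.range (p.n + 1), racahCoeff p σ j • splitVec p a Ω j

theorem racahCoeff_zero (p : Params) (σ : ℂ) : racahCoeff p σ 0 = 1 := by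
  simp [racahCoeff, Params.nodeProd]

theorem racahCoeff_succ (p : Params) (σ : ℂ) (j : ℕ) : racahCoeff p σ (j + 1)
    = racahCoeff p σ j * ((p.bs * σ + p.cs * σ⁻¹ - p.θs j) / p.splitCoeff (p.q ^ (2 * j))) := by
  rw [racahCoeff, racahCoeff, Params.nodeProd, Finset.prod_range_succ, Finset.prod_range_succ,
    ← Params.nodeProd, mul_div_mul_comm]

theorem racahCoeff_eq_zero {N j : ℕ} (h : N < j) : racahCoeff p (p.q ^ (2 * N)) j = 0 := by
  rw [racahCoeff, Params.nodeProd, Finset.prod_eq_zero (Finset.mem_range.2 h), zero_div]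
  rw [p.θs_eq, sub_self]

namespace IsAWPair

/-- The bidiagonal system is solved by the coefficients `racahCoeff`; in the last row `c_n (θ*_n - θ*_N)`
vanishes because of the truncation for `N < n`. -/
theorem apply_racahVec (hp : p.Valid) (h : IsAWPair p a s) {Ω : W} (hΩ0 : Ω ≠ 0)
    (hΩ : s Ω = p.θs 0 • Ω) {N : ℕ} (hN : N ≤ p.n) :
    s (racahVec p a Ω (p.q ^ (2 * N))) = p.θs N • racahVec p a Ω (p.q ^ (2 * N)) := by
  set c := racahCoeff p (p.q ^ (2 * N)) with hc
  have hrec : ∀ j < p.n, c (j + 1) * p.splitCoeff (p.q ^ (2 * j)) = c j * (p.θs N - p.θs j) := by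
    intro j hj
    have := h.splitCoeff_ne_zero hp hΩ0 hΩ hj
    rw [hc, racahCoeff_succ, ← p.θs_eq]
    field_simp
  have hlast : c p.n * p.θs p.n = c p.n * p.θs N := by
    rcases hN.eq_or_lt with rfl | hlt
    · rfl
    · rw [hc, racahCoeff_eq_zero hlt, zero_mul, zero_mul]
  rw [racahVec, map_sum, Finset.smul_sum, ← hc, Finset.sum_range_succ']
  simp only [map_smul, h.apply_splitVec_succ hp hΩ]
  have h0 : s (splitVec p a Ω 0) = p.θs 0 • splitVec p a Ω 0 := hΩ
  have e1 : ∑ j ∈ Finset.range p.n, c (j + 1) • p.θs (j + 1) • splitVec p a Ω (j + 1)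
      + c 0 • p.θs 0 • splitVec p a Ω 0
      = ∑ j ∈ Finset.range (p.n + 1), c j • p.θs j • splitVec p a Ω j := by
    rw [Finset.sum_range_succ']
  rw [h0]
  simp only [smul_add, Finset.sum_add_distrib]
  rw [add_right_comm, e1, Finset.sum_range_succ, Finset.sum_range_succ, add_right_comm,
    ← Finset.sum_add_distrib, smul_smul, hlast, smul_smul, mul_comm (c p.n)]
  congr 1
  refine Finset.sum_congr rfl fun j hj => ?_
  rw [smul_smul, smul_smul, smul_smul, hrec j (Finset.mem_range.1 hj), ← add_smul]
  congr 1
  ring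

/-- In the basis of eigenvectors of `s` the operator `a` is tridiagonal. -/
theorem apply_racahVec_three_term (hp : p.Valid) (h : IsAWPair p a s) {Ω : W} (hΩ0 : Ω ≠ 0)
    (hΩ : s Ω = p.θs 0 • Ω) {σ : ℂ} (hσ : σ ≠ 0)
    (h1 : p.cs - p.bs * (σ ^ 2 * (p.q ^ 2)⁻¹) ≠ 0) (h2 : p.cs - p.bs * σ ^ 2 ≠ 0)
    (h3 : p.cs - p.bs * (σ ^ 2 * p.q ^ 2) ≠ 0) :
    a (racahVec p a Ω σ) = p.lowerCoeff σ • racahVec p a Ω (σ * (p.q ^ 2)⁻¹)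
      + (p.θ 0 - p.lowerCoeff σ - p.upperCoeff σ) • racahVec p a Ω σ
      + p.upperCoeff σ • racahVec p a Ω (σ * p.q ^ 2) := by
  have hrec : ∀ j < p.n, racahCoeff p σ j + racahCoeff p σ (j + 1) * p.θ (j + 1)
      = p.lowerCoeff σ * racahCoeff p (σ * (p.q ^ 2)⁻¹) (j + 1)
      + (p.θ 0 - p.lowerCoeff σ - p.upperCoeff σ) * racahCoeff p σ (j + 1)
      + p.upperCoeff σ * racahCoeff p (σ * p.q ^ 2) (j + 1) := by
    intro j hj
    have hφ := h.splitCoeff_ne_zero hp hΩ0 hΩ hj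
    have hprod : ∏ i ∈ Finset.range j, p.splitCoeff (p.q ^ (2 * i)) ≠ 0 :=
      Finset.prod_ne_zero_iff.2 fun i hi =>
        h.splitCoeff_ne_zero hp hΩ0 hΩ ((Finset.mem_range.1 hi).trans hj)
    have hkey := hp.nodeProd_three_term j hσ h1 h2 h3
    simp only [racahCoeff, Finset.prod_range_succ]
    generalize p.nodeProd (j + 1) (σ * (p.q ^ 2)⁻¹) = t at *
    field_simp
    linear_combination hkey
  have e1 : a (racahVec p a Ω σ) = ∑ j ∈ Finset.range p.n,
      (racahCoeff p σ j + racahCoeff p σ (j + 1) * p.θ (j + 1)) • splitVec p a Ω (j + 1)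
      + p.θ 0 • splitVec p a Ω 0 := by
    rw [racahVec, map_sum]
    simp only [map_smul, apply_splitVec, smul_add, Finset.sum_add_distrib, add_smul]
    rw [Finset.sum_range_succ, h.splitVec_eq_zero Ω (Nat.lt_succ_self _), smul_zero, add_zero,
      Finset.sum_range_succ' (fun j => racahCoeff p σ j • p.θ j • splitVec p a Ω j),
      racahCoeff_zero, one_smul, add_assoc]
    simp only [smul_smul]
  rw [e1, Finset.sum_congr rfl fun j hj => by rw [hrec j (Finset.mem_range.1 hj)]]
  simp only [racahVec, Finset.sum_range_succ' _ p.n, racahCoeff_zero, add_smul, mul_smul,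
    Finset.sum_add_distrib, Finset.smul_sum, smul_add]
  module

end IsAWPair

end

/-! ### Overlaps and `q`-Racah polynomials -/

section

theorem qPoch_succ (a Q : ℂ) (k : ℕ) : qPoch a Q (k + 1) = qPoch a Q k * (1 - a * Q ^ k) :=
  Finset.prod_range_succ _ _

theorem qPoch_ne_zero {a Q : ℂ} {k : ℕ} (h : ∀ j < k, 1 - a * Q ^ j ≠ 0) : qPoch a Q k ≠ 0 :=
  Finset.prod_ne_zero_iff.2 fun j hj => h j (Finset.mem_range.1 hj)

namespace Params

variable {p : Params}

theorem qPoch_zpow_neg_eq_zero (hq : p.q ≠ 0) {N k : ℕ} (h : N < k) :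
    qPoch (p.q ^ (-2 * (N : ℤ))) (p.q ^ 2) k = 0 := by
  refine Finset.prod_eq_zero (Finset.mem_range.2 h) ?_
  have h1 : p.q ^ (-2 * (N : ℤ)) * (p.q ^ 2) ^ N = 1 := by
    rw [neg_mul, zpow_neg, ← pow_mul]
    norm_cast
    exact inv_mul_cancel₀ (pow_ne_zero _ hq)
  rw [h1, sub_self]

theorem splitCoeff_factor₁ {k : ℕ} (h : p.splitCoeff (p.q ^ (2 * k)) ≠ 0) :
    1 - -(p.b / p.cs) * p.q ^ (p.n + 1) * p.ζ ^ 2 * (p.q ^ 2) ^ k ≠ 0 := by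
  intro h0
  apply h
  rw [splitCoeff, show 1 + p.b / p.cs * (p.q ^ p.n * p.q * p.q ^ (2 * k)) * p.ζ ^ 2 = 0 by
    rw [← h0, pow_mul]; ring]
  simp

theorem splitCoeff_factor₂ {k : ℕ} (h : p.splitCoeff (p.q ^ (2 * k)) ≠ 0) :
    1 - -(p.bs / p.c) * p.q ^ (p.n + 1) * p.ζ ^ (-2 : ℤ) * (p.q ^ 2) ^ k ≠ 0 := by
  intro h0
  apply h
  rw [splitCoeff, show 1 + p.bs / p.c * (p.q ^ p.n * p.q * p.q ^ (2 * k)) * (p.ζ ^ 2)⁻¹ = 0 by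
    rw [← h0, pow_mul, zpow_neg]; norm_cast; ring]
  simp

theorem splitCoeff_factor₃ {k : ℕ} (h : p.splitCoeff (p.q ^ (2 * k)) ≠ 0) :
    1 - p.q ^ (-2 * (p.n : ℤ)) * (p.q ^ 2) ^ k ≠ 0 := by
  intro h0
  apply h
  rw [splitCoeff, show 1 - p.q ^ (2 * k) * ((p.q ^ p.n) ^ 2)⁻¹ = 0 by
    rw [← h0, pow_mul, neg_mul, zpow_neg, ← pow_mul p.q p.n, mul_comm p.n]; norm_cast; ring]
  simp

/-- The `q`-Racah polynomial as a sum over the split basis. -/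
theorem Valid.qRacah_eq_sum (hp : p.Valid) (hφ : ∀ k < p.n, p.splitCoeff (p.q ^ (2 * k)) ≠ 0)
    {M N : ℕ} (hN : N ≤ p.n) :
    p.qRacah M N = ∑ k ∈ Finset.range (p.n + 1),
      racahCoeff p (p.q ^ (2 * N)) k * ∏ j ∈ Finset.range k, (p.θ M - p.θ j) := by
  have hq := hp.q_ne
  have hb := hp.b_ne
  have hc := hp.c_ne
  have hcs := hp.cs_ne
  have hζ := hp.ζ_ne
  have hQ : p.q ^ p.n ≠ 0 := pow_ne_zero _ hq
  rw [qRacah, fourPhiThree, tsum_eq_sum (s := Finset.range (p.n + 1))]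
  swap
  · intro k hk
    rw [Finset.mem_range, not_lt] at hk
    rw [qPoch_zpow_neg_eq_zero hq (show N < k by omega)]
    simp
  refine Finset.sum_congr rfl fun k hk => ?_
  rw [Finset.mem_range, Nat.lt_succ_iff] at hk
  induction k with
  | zero => simp [qPoch, racahCoeff_zero]
  | succ k ih =>
    have h0 := hφ k hk
    have f1 := splitCoeff_factor₁ h0
    have f2 := splitCoeff_factor₂ h0
    have f3 := splitCoeff_factor₃ h0
    have f4 : 1 - p.q ^ 2 * (p.q ^ 2) ^ k ≠ 0 := by
      intro h
      apply h0
      rw [splitCoeff, pow_mul, h, mul_zero]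
    have ratio : (1 - p.q ^ (-2 * (M : ℤ)) * (p.q ^ 2) ^ k)
        * (1 - p.b / p.c * p.q ^ (2 * M) * (p.q ^ 2) ^ k)
        * (1 - p.q ^ (-2 * (N : ℤ)) * (p.q ^ 2) ^ k)
        * (1 - p.bs / p.cs * p.q ^ (2 * N) * (p.q ^ 2) ^ k)
        / ((1 - -(p.b / p.cs) * p.q ^ (p.n + 1) * p.ζ ^ 2 * (p.q ^ 2) ^ k)
          * (1 - -(p.bs / p.c) * p.q ^ (p.n + 1) * p.ζ ^ (-2 : ℤ) * (p.q ^ 2) ^ k)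
          * (1 - p.q ^ (-2 * (p.n : ℤ)) * (p.q ^ 2) ^ k)
          * (1 - p.q ^ 2 * (p.q ^ 2) ^ k)) * p.q ^ 2
        = (p.bs * p.q ^ (2 * N) + p.cs * (p.q ^ (2 * N))⁻¹ - p.θs k) / p.splitCoeff (p.q ^ (2 * k))
          * (p.θ M - p.θ k) := by
      have hden : p.splitCoeff (p.q ^ (2 * k)) = p.c * p.cs * (p.q ^ 2 * (p.q ^ (2 * k)) ^ 2)⁻¹ *
          ((1 - -(p.b / p.cs) * p.q ^ (p.n + 1) * p.ζ ^ 2 * (p.q ^ 2) ^ k)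
          * (1 - -(p.bs / p.c) * p.q ^ (p.n + 1) * p.ζ ^ (-2 : ℤ) * (p.q ^ 2) ^ k)
          * (1 - p.q ^ (-2 * (p.n : ℤ)) * (p.q ^ 2) ^ k)
          * (1 - p.q ^ 2 * (p.q ^ 2) ^ k)) := by
        simp only [splitCoeff, neg_mul, zpow_neg]
        rw [← pow_mul p.q p.n, mul_comm p.n 2, pow_mul p.q 2 k]
        norm_cast
        ring
      rw [hden]
      have hden0 := mul_ne_zero (mul_ne_zero (mul_ne_zero f1 f2) f3) f4
      generalize (1 - -(p.b / p.cs) * p.q ^ (p.n + 1) * p.ζ ^ 2 * (p.q ^ 2) ^ k)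
          * (1 - -(p.bs / p.c) * p.q ^ (p.n + 1) * p.ζ ^ (-2 : ℤ) * (p.q ^ 2) ^ k)
          * (1 - p.q ^ (-2 * (p.n : ℤ)) * (p.q ^ 2) ^ k)
          * (1 - p.q ^ 2 * (p.q ^ 2) ^ k) = d at *
      have e1 : p.q ^ (-2 * (M : ℤ)) = (p.q ^ (2 * M))⁻¹ := by
        rw [neg_mul, zpow_neg]; norm_cast
      have e2 : p.q ^ (-2 * (N : ℤ)) = (p.q ^ (2 * N))⁻¹ := by
        rw [neg_mul, zpow_neg]; norm_cast
      rw [e1, e2, θ_eq, θ_eq, θs_eq, ← pow_mul]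
      have g1 : p.q ^ (2 * M) ≠ 0 := pow_ne_zero _ hq
      have g2 : p.q ^ (2 * N) ≠ 0 := pow_ne_zero _ hq
      have g3 : p.q ^ (2 * k) ≠ 0 := pow_ne_zero _ hq
      clear hden f1 f2 f3 f4 ih h0 e1 e2
      generalize p.q ^ (2 * M) = x at *
      generalize p.q ^ (2 * N) = σ at *
      generalize p.q ^ (2 * k) = y at *
      field_simp
      ring
    rw [racahCoeff_succ, Finset.prod_range_succ, mul_mul_mul_comm, ← ih (by omega), ← ratio]
    simp only [qPoch_succ, pow_succ (p.q ^ 2) k, div_eq_mul_inv, mul_inv]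
    ring

end Params

variable {V : Type*} [AddCommGroup V] [Module ℂ V] {p : Params} {A As : End ℂ V}

theorem dualMap_aeval (Y : End ℂ V) (P : ℂ[X]) : (aeval Y P).dualMap = aeval Y.dualMap P := by
  induction P using Polynomial.induction_on' with
  | add P Q h1 h2 => rw [map_add, map_add, ← h1, ← h2]; ext φ x; simp
  | monomial k a =>
    rw [← C_mul_X_pow_eq_monomial, ← smul_eq_C_mul, map_smul, map_smul, map_pow, map_pow, aeval_X,
      aeval_X]
    have : ∀ k : ℕ, (Y ^ k).dualMap = Y.dualMap ^ k := by
      intro k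
      induction k with
      | zero => rfl
      | succ k ih => rw [pow_succ, dualMap_mul, ih, pow_succ']
    rw [← this]
    ext φ x
    simp

theorem splitVec_dualMap_apply {x : V} {θ : ℂ} (hx : A x = θ • x) (Ω' : Dual ℂ V) (k : ℕ) :
    splitVec p A.dualMap Ω' k x = (∏ j ∈ Finset.range k, (θ - p.θ j)) * Ω' x := by
  induction k with
  | zero => simp [splitVec]
  | succ k ih =>
    rw [splitVec, LinearMap.sub_apply, LinearMap.smul_apply, LinearMap.dualMap_apply, hx, map_smul, ih,
      Finset.prod_range_succ, smul_eq_mul, smul_eq_mul]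
    ring

/-- At `N = 0` the nodal product truncates the sum to the reference covector. -/
theorem racahVec_one (Ω' : Dual ℂ V) : racahVec p A.dualMap Ω' (p.q ^ (2 * 0)) = Ω' := by
  rw [racahVec, Finset.sum_range_succ', racahCoeff_zero, one_smul, Finset.sum_eq_zero, zero_add]
  · rfl
  · intro k _
    rw [racahCoeff_eq_zero (Nat.succ_pos k), zero_smul]

namespace IsAWPair

variable {Ω' : Dual ℂ V}

/-- The `q`-Racah polynomials are the ratios of overlaps of the eigenvectors of `A` with the
eigencovectors of `A*`. -/
theorem racahVec_apply (hp : p.Valid) (h : IsAWPair p A As) (hΩ'0 : Ω' ≠ 0)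
    (hΩ' : As.dualMap Ω' = p.θs 0 • Ω') {M N : ℕ} (hN : N ≤ p.n) {x : V} (hx : A x = p.θ M • x) :
    racahVec p A.dualMap Ω' (p.q ^ (2 * N)) x = p.qRacah M N * Ω' x := by
  rw [hp.qRacah_eq_sum (fun k hk => (h.dual hp).splitCoeff_ne_zero hp hΩ'0 hΩ' hk) hN, racahVec,
    LinearMap.sum_apply, Finset.sum_mul]
  refine Finset.sum_congr rfl fun k _ => ?_
  rw [LinearMap.smul_apply, splitVec_dualMap_apply hx, smul_eq_mul, mul_assoc]

/-- On an eigenvector of `A` all split covectors are multiples of the reference covector, and they span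
the dual space. -/
theorem apply_ne_zero_of_eigenvector (hp : p.Valid) (h : IsAWPair p A As) (hΩ'0 : Ω' ≠ 0)
    (hΩ' : As.dualMap Ω' = p.θs 0 • Ω') {θ : ℂ} {x : V} (hx : A x = θ • x) (hx0 : x ≠ 0) :
    Ω' x ≠ 0 := by
  intro h0
  have hfin := h.finiteDimensional
  apply hx0
  rw [← Module.forall_dual_apply_eq_zero_iff ℂ]
  intro φ
  have hφ : φ ∈ Submodule.span ℂ (Set.range fun k : Fin (p.n + 1) => splitVec p A.dualMap Ω' k) := by
    rw [(h.dual hp).span_splitVec hp hΩ'0 hΩ']; trivial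
  induction hφ using Submodule.span_induction with
  | mem y hy =>
    obtain ⟨k, rfl⟩ := hy
    simp only [splitVec_dualMap_apply hx, h0, mul_zero]
  | zero => rfl
  | add y z _ _ hy hz => rw [LinearMap.add_apply, hy, hz, add_zero]
  | smul c y _ hy => rw [LinearMap.smul_apply, hy, smul_zero]

theorem racahVec_ne_zero (hp : p.Valid) (h : IsAWPair p A As) {Ω : V} (hΩ0 : Ω ≠ 0)
    (hΩ : As Ω = p.θs 0 • Ω) (σ : ℂ) : racahVec p A Ω σ ≠ 0 := by
  intro h0
  have hli := h.linearIndependent_splitVec hp hΩ0 hΩ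
  rw [racahVec, ← Fin.sum_univ_eq_sum_range (fun j => racahCoeff p σ j • splitVec p A Ω j)] at h0
  have h1 := Fintype.linearIndependent_iff.1 hli (fun j => racahCoeff p σ j) h0 0
  rw [Fin.val_zero, racahCoeff_zero] at h1
  exact one_ne_zero h1

/-- The eigencovector for `θ*_j` annihilates the eigenvectors of `A*` for the other eigenvalues. -/
theorem racahVec_apply_eq_zero (hp : p.Valid) (h : IsAWPair p A As) (hΩ'0 : Ω' ≠ 0)
    (hΩ' : As.dualMap Ω' = p.θs 0 • Ω') {j N : ℕ} (hj : j ≤ p.n) (hN : N ≤ p.n) (hjN : j ≠ N)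
    {x : V} (hx : As x = p.θs N • x) : racahVec p A.dualMap Ω' (p.q ^ (2 * j)) x = 0 := by
  have h1 := LinearMap.congr_fun ((h.dual hp).apply_racahVec hp hΩ'0 hΩ' hj) x
  rw [LinearMap.dualMap_apply, hx, map_smul, LinearMap.smul_apply, smul_eq_mul, smul_eq_mul] at h1
  have h2 : p.θs N - p.θs j ≠ 0 := fun h3 => hjN (h.θs_inj _ hN _ hj (sub_eq_zero.1 h3)).symm
  refine (mul_eq_zero.1 (?_ : (p.θs N - p.θs j) * _ = 0)).resolve_left h2
  rw [sub_mul, h1, sub_self]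

/-- The eigencovectors of `A*` form a basis, and all but the `N`-th one annihilate `x`. -/
theorem racahVec_apply_ne_zero (hp : p.Valid) (h : IsAWPair p A As) (hΩ'0 : Ω' ≠ 0)
    (hΩ' : As.dualMap Ω' = p.θs 0 • Ω') {N : ℕ} (hN : N ≤ p.n)
    {x : V} (hx0 : x ≠ 0) (hx : As x = p.θs N • x) :
    racahVec p A.dualMap Ω' (p.q ^ (2 * N)) x ≠ 0 := by
  intro h0
  have hfin := h.finiteDimensional
  have hd := h.dual hp
  have hli : LinearIndependent ℂ
      (fun k : Fin (p.n + 1) => racahVec p A.dualMap Ω' (p.q ^ (2 * (k : ℕ)))) := by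
    refine Module.End.eigenvectors_linearIndependent' (M := Dual ℂ V) As.dualMap
      (fun k : Fin (p.n + 1) => p.θs k) ?_ _ ?_
    · intro i j hij
      exact Fin.ext (h.θs_inj i (by omega) j (by omega) hij)
    · intro k
      exact ⟨Module.End.mem_eigenspace_iff.2 (hd.apply_racahVec hp hΩ'0 hΩ' (by omega)),
        hd.racahVec_ne_zero hp hΩ'0 hΩ' _⟩
  have hspan := hli.span_eq_top_of_card_eq_finrank (by rw [Fintype.card_fin, hd.finrank_eq])
  apply hx0
  rw [← Module.forall_dual_apply_eq_zero_iff ℂ]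
  intro φ
  have hφ : φ ∈ Submodule.span ℂ (Set.range
      fun k : Fin (p.n + 1) => racahVec p A.dualMap Ω' (p.q ^ (2 * (k : ℕ)))) := by
    rw [hspan]; trivial
  induction hφ using Submodule.span_induction with
  | mem y hy =>
    obtain ⟨k, rfl⟩ := hy
    rcases eq_or_ne (k : ℕ) N with hk | hk
    · simp only [hk, h0]
    · exact h.racahVec_apply_eq_zero hp hΩ'0 hΩ' (by omega) hN hk hx
  | zero => rfl
  | add y z _ _ hy hz => rw [LinearMap.add_apply, hy, hz, add_zero]
  | smul c y _ hy => rw [LinearMap.smul_apply, hy, smul_zero]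

/-- The transposed shifted `q`-commutator is tridiagonal in the basis of eigencovectors of `A*`. -/
theorem exists_dualMap_shiftedComm_racahVec (hp : p.Valid) (h : IsAWPair p A As) (hΩ'0 : Ω' ≠ 0)
    (hΩ' : As.dualMap Ω' = p.θs 0 • Ω') {N : ℕ} (hN : N + 1 ≤ p.n) :
    ∃ r t : ℂ, (t = 0 ∨ N + 2 ≤ p.n) ∧
      (shiftedComm p A As).dualMap (racahVec p A.dualMap Ω' (p.q ^ (2 * (N + 1))))
      = (p.ASub (N + 1) * (p.bs * p.q ^ (2 * N + 1) * (p.q ^ 2 - (p.q ^ 2)⁻¹))) •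
          racahVec p A.dualMap Ω' (p.q ^ (2 * N))
        + r • racahVec p A.dualMap Ω' (p.q ^ (2 * (N + 1)))
        + t • racahVec p A.dualMap Ω' (p.q ^ (2 * (N + 2))) := by
  have hq := hp.q_ne
  have hd := h.dual hp
  have hσ : p.q ^ (2 * (N + 1)) ≠ 0 := pow_ne_zero _ hq
  have e1 : p.q ^ (2 * (N + 1)) * (p.q ^ 2)⁻¹ = p.q ^ (2 * N) := by
    rw [mul_add, pow_add]; field_simp
  have e2 : p.q ^ (2 * (N + 1)) * p.q ^ 2 = p.q ^ (2 * (N + 2)) := by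
    rw [← pow_add]; congr 1
  have h3 := hd.apply_racahVec_three_term hp hΩ'0 hΩ' hσ
    (hp.den_ne (k := 2 * N + 1) (by omega) (by omega) (by
      rw [← div_eq_mul_inv, ← pow_mul, div_eq_iff (pow_ne_zero _ hq)]
      norm_cast
      rw [← pow_add]; congr 1; ring))
    (hp.den_ne (k := 2 * N + 2) (by omega) (by omega) (by
      rw [← pow_mul]
      norm_cast
      congr 1; ring))
    (hp.den_ne (k := 2 * N + 3) (by omega) (by omega) (by
      rw [← pow_mul, ← pow_add]
      norm_cast
      congr 1; ring))
  rw [e1, e2, hp.lowerCoeff_eq_ASub] at h3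
  set g₀ := racahVec p A.dualMap Ω' (p.q ^ (2 * N))
  set g₁ := racahVec p A.dualMap Ω' (p.q ^ (2 * (N + 1)))
  set g₂ := racahVec p A.dualMap Ω' (p.q ^ (2 * (N + 2)))
  set D := p.ASub (N + 1)
  set B := p.upperCoeff (p.q ^ (2 * (N + 1)))
  have s0 : As.dualMap g₀ = p.θs N • g₀ := hd.apply_racahVec hp hΩ'0 hΩ' (by omega)
  have s1 : As.dualMap g₁ = p.θs (N + 1) • g₁ := hd.apply_racahVec hp hΩ'0 hΩ' (by omega)
  have hB : B = 0 ∨ N + 2 ≤ p.n := by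
    rcases hN.eq_or_lt with hN' | hN'
    · left
      simp only [B, Params.upperCoeff]
      rw [hN', ← pow_mul, mul_comm 2, mul_inv_cancel₀ (pow_ne_zero _ hq)]
      simp
    · exact Or.inr hN'
  -- for `N + 1 = n` there is no eigencovector with the next index, but its coefficient vanishes
  have s2 : B • As.dualMap g₂ = B • p.θs (N + 2) • g₂ := by
    rcases hB with hB | hB
    · rw [hB, zero_smul, zero_smul]
    · rw [show As.dualMap g₂ = p.θs (N + 2) • g₂ from hd.apply_racahVec hp hΩ'0 hΩ' hB]
  refine ⟨(p.θ 0 - D - B) * ((p.q - p.q⁻¹) * p.θs (N + 1)) + p.ω / (p.q - p.q⁻¹),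
    B * (p.q * p.θs (N + 1) - p.q⁻¹ * p.θs (N + 2)), ?_, ?_⟩
  · rcases hB with hB | hB
    · left; rw [hB, zero_mul]
    · exact Or.inr hB
  · have hc : p.q * p.θs (N + 1) - p.q⁻¹ * p.θs N
        = p.bs * p.q ^ (2 * N + 1) * (p.q ^ 2 - (p.q ^ 2)⁻¹) := by
      simp only [Params.θs_eq, mul_add, pow_add]
      have : p.q ^ (2 * N) ≠ 0 := pow_ne_zero _ hq
      field_simp
      ring
    rw [← hc, dualMap_shiftedComm hp, shiftedComm, hp.ω_swap, show p.swap.q = p.q from rfl]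
    simp only [qComm, LinearMap.add_apply, LinearMap.sub_apply, LinearMap.smul_apply,
      Module.End.mul_apply, Module.End.one_apply, s1, h3, map_add, map_smul, s0, s2]
    module

/-- The triangular action of powers of the shifted `q`-commutator on `Ω`, in coordinates given by
the eigencovectors of `A*`. -/
theorem racahVec_pow_apply (hp : p.Valid) (h : IsAWPair p A As) (hΩ'0 : Ω' ≠ 0)
    (hΩ' : As.dualMap Ω' = p.θs 0 • Ω') {Ω : V} (hΩ : As Ω = p.θs 0 • Ω) (k N : ℕ) (hk : k ≤ N)
    (hN : N ≤ p.n) :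
    racahVec p A.dualMap Ω' (p.q ^ (2 * N)) ((shiftedComm p A As ^ k) Ω)
      = if k = N then (∏ j ∈ Finset.range N,
          p.ASub (j + 1) * (p.bs * p.q ^ (2 * j + 1) * (p.q ^ 2 - (p.q ^ 2)⁻¹))) * Ω' Ω else 0 := by
  induction k generalizing N with
  | zero =>
    rw [pow_zero, Module.End.one_apply]
    rcases Nat.eq_zero_or_pos N with rfl | hN0
    · rw [racahVec_one]; simp
    · rw [if_neg hN0.ne, h.racahVec_apply_eq_zero hp hΩ'0 hΩ' hN (Nat.zero_le _) hN0.ne' hΩ]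
  | succ k ih =>
    obtain ⟨N, rfl⟩ : ∃ j, N = j + 1 := Nat.exists_eq_add_of_le' (by omega)
    obtain ⟨r, t, ht, hX⟩ := h.exists_dualMap_shiftedComm_racahVec hp hΩ'0 hΩ' hN
    rw [pow_succ', Module.End.mul_apply, ← LinearMap.dualMap_apply, hX]
    simp only [LinearMap.add_apply, LinearMap.smul_apply, smul_eq_mul]
    rw [ih N (by omega) (by omega), ih (N + 1) (by omega) hN,
      if_neg (show ¬ k = N + 1 by omega), mul_zero, add_zero]
    have h2 : t * racahVec p A.dualMap Ω' (p.q ^ (2 * (N + 2))) ((shiftedComm p A As ^ k) Ω) = 0 := by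
      rcases ht with ht | ht
      · rw [ht, zero_mul]
      · rw [ih (N + 2) (by omega) ht, if_neg (by omega), mul_zero]
    rw [h2, add_zero]
    simp only [Nat.add_right_cancel_iff]
    split_ifs
    · rw [Finset.prod_range_succ]; ring
    · rw [mul_zero]

/-- Only the leading monomial of `P` contributes, so the value does not depend on the zeros of `P`. -/
theorem racahVec_aeval_apply (hp : p.Valid) (h : IsAWPair p A As) (hΩ'0 : Ω' ≠ 0)
    (hΩ' : As.dualMap Ω' = p.θs 0 • Ω') {Ω : V} (hΩ : As Ω = p.θs 0 • Ω) {N : ℕ} (hN : N ≤ p.n)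
    {P : ℂ[X]} (hP : P.Monic) (hdeg : P.natDegree = N) :
    racahVec p A.dualMap Ω' (p.q ^ (2 * N)) (aeval (shiftedComm p A As) P Ω)
      = (∏ j ∈ Finset.range N,
          p.ASub (j + 1) * (p.bs * p.q ^ (2 * j + 1) * (p.q ^ 2 - (p.q ^ 2)⁻¹))) * Ω' Ω := by
  rw [aeval_eq_sum_range, LinearMap.sum_apply, map_sum, hdeg, Finset.sum_range_succ,
    Finset.sum_eq_zero, zero_add, ← hdeg, hP.coeff_natDegree, one_smul, hdeg,
    h.racahVec_pow_apply hp hΩ'0 hΩ' hΩ N N le_rfl hN, if_pos rfl]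
  intro k hk
  rw [Finset.mem_range] at hk
  rw [LinearMap.smul_apply, map_smul, h.racahVec_pow_apply hp hΩ'0 hΩ' hΩ k N hk.le hN,
    if_neg hk.ne, smul_zero]

end IsAWPair

end

/-! ### Normalization of the Bethe states -/

section

variable {V : Type*} [AddCommGroup V] [Module ℂ V] {p : Params} {A As : End ℂ V}

theorem Params.Valid.bethePoly_swap (hp : p.Valid) {M : ℕ} (u : Fin M → ℂ) :
    p.swap.bethePoly u = p.bethePoly u := by
  simp only [Params.bethePoly, Params.specX, hp.ρ_swap]
  rfl

/-- A Bethe ket is a nonzero multiple of its Bethe polynomial in `X`, applied to the reference vector. -/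
theorem exists_betheKet_eq (hp : p.Valid) {ε : ℤ} (hε : ε ≠ 0) {α : ℂ} {m : ℤ}
    (hγ : ∀ k : ℤ, gammaFn p ε α 0 1 k ≠ 0) {M : ℕ} {u : Fin M → ℂ}
    (hu : p.IsBetheSolution ε u) (Ω : V) :
    ∃ s : ℂ, s ≠ 0 ∧
      betheKet p A As ε α m Ω u = s • aeval (shiftedComm p A As) (p.bethePoly u) Ω := by
  rw [betheKet, stringB_eq hp, LinearMap.smul_apply]
  refine ⟨_, ?_, rfl⟩
  exact Finset.prod_ne_zero_iff.2 fun i _ =>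
    dynScalar_ne_zero hp hε (hγ _) (hu.ne_zero i) (hu.bf_ne i)

theorem exists_betheBra_eq (hp : p.Valid) {ε : ℤ} (hε : ε ≠ 0) {β : ℂ} {m : ℤ}
    (hγ : ∀ k : ℤ, gammaFn p ε 0 β 1 k ≠ 0) {N : ℕ} {v : Fin N → ℂ}
    (hv : p.IsBetheSolution ε v) (Ω' : Dual ℂ V) :
    ∃ s : ℂ, s ≠ 0 ∧ betheBra p A As ε β m Ω' v
      = s • aeval (shiftedComm p A As).dualMap (p.bethePoly v) Ω' := by
  rw [betheBra, stringC_eq hp, LinearMap.comp_smul, ← dualMap_aeval]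
  refine ⟨_, ?_, rfl⟩
  exact Finset.prod_ne_zero_iff.2 fun i _ =>
    neg_ne_zero.2 (dynScalar_ne_zero hp hε (hγ _) (hv.ne_zero i) (hv.bf_ne i))

/-- The scalars of the Bethe ket, with the gauge parameter `α` fixed by its normalization, turn the
lower coefficients of `X` into those of `A` that enter `𝒩*_N(v)`. -/
theorem prod_dynScalar_mul_prod (hp : p.Valid) {α : ℂ} {m : ℤ}
    (hα : (p.q ^ 2 - p.q ^ (-2 : ℤ)) * p.χ⁻¹ * α * p.cs * p.q ^ m = 1) {N : ℕ} (v : Fin N → ℂ) :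
    (∏ i : Fin N, dynScalar p 1
        (gammaFn p 1 α 0 1 (m + 2 * ((N : ℤ) - 1 - ((i : ℕ) : ℤ)) + 1)) (v i))
      * ∏ j ∈ Finset.range N,
          p.ASub (j + 1) * (p.bs * p.q ^ (2 * j + 1) * (p.q ^ 2 - (p.q ^ 2)⁻¹))
      = (p.normStar v)⁻¹ := by
  have hq := hp.q_ne
  have hα0 : α ≠ 0 := by rintro rfl; simp at hα
  -- The part of the `(N - 1 - j)`-th scalar that does not depend on the Bethe root. The dynamical
  -- parameter decreases along the string, which reverses the order of the factors.
  set w : ℕ → ℂ := fun j => -p.χ * p.ρ⁻¹ * (α * p.q ^ (m + 2 * (j : ℤ) + 1))⁻¹ with hw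
  have hw1 : ∀ j, w j * (p.bs * p.q ^ (2 * j + 1) * (p.q ^ 2 - (p.q ^ 2)⁻¹)) = 1 := by
    intro j
    have e1 : p.q ^ (m + 2 * (j : ℤ) + 1) = p.q ^ m * p.q ^ (2 * j + 1) := by
      rw [add_assoc, zpow_add₀ hq]; norm_cast
    have hm : p.q ^ m ≠ 0 := zpow_ne_zero _ hq
    have hj : p.q ^ (2 * j + 1) ≠ 0 := pow_ne_zero _ hq
    have hd : p.q ^ 2 - (p.q ^ 2)⁻¹ ≠ 0 := by simpa [zpow_neg] using hp.sq_sub_ne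
    have hα' : (p.q ^ 2 - (p.q ^ 2)⁻¹) * α * p.cs * p.q ^ m = p.χ := by
      have hχ := hp.χ_ne
      have e2 : p.q ^ (-2 : ℤ) = (p.q ^ 2)⁻¹ := by rw [zpow_neg]; norm_cast
      rw [e2] at hα
      have := congrArg (p.χ * ·) hα
      simp only [mul_one] at this
      rw [← this]
      field_simp
    have hbs := hp.bs_ne
    have hcs := hp.cs_ne
    simp only [hw]
    rw [e1, ← hα', p.ρ_eq, hp.bc_eq]
    generalize p.q ^ 2 - (p.q ^ 2)⁻¹ = d at *
    field_simp
  have h1 : ∀ i : Fin N, dynScalar p 1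
      (gammaFn p 1 α 0 1 (m + 2 * ((N : ℤ) - 1 - ((i : ℕ) : ℤ)) + 1)) (v i)
      = (-p.q⁻¹ * (v i)⁻¹ * bf (v i ^ 2)) * w (Fin.rev i) := by
    intro i
    have : ((Fin.rev i : ℕ) : ℤ) = (N : ℤ) - 1 - ((i : ℕ) : ℤ) := by
      rw [Fin.val_rev]; omega
    simp only [hw, this, dynScalar, gammaFn_one, zpow_neg, zpow_one, mul_inv, Int.cast_one,
      div_eq_mul_inv, inv_neg]
    ring
  have h2 : ∏ i : Fin N, w (Fin.rev i) = ∏ j ∈ Finset.range N, w j := by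
    rw [← Fin.prod_univ_eq_prod_range]
    exact Equiv.prod_comp Fin.revPerm (fun i : Fin N => w i)
  simp only [h1]
  rw [Finset.prod_mul_distrib, h2, mul_assoc, ← Finset.prod_mul_distrib]
  have h3 : ∀ j, w j * (p.ASub (j + 1) * (p.bs * p.q ^ (2 * j + 1) * (p.q ^ 2 - (p.q ^ 2)⁻¹)))
      = p.ASub (j + 1) := fun j => by rw [mul_left_comm, hw1, mul_one]
  simp only [h3]
  rw [← Fin.prod_univ_eq_prod_range (fun j => p.ASub (j + 1)), ← Finset.prod_mul_distrib,
    Params.normStar, Finset.prod_inv_distrib, inv_inv]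

theorem IsAWPair.racahVec_betheKet (hp : p.Valid) (h : IsAWPair p A As) {Ω' : Dual ℂ V}
    (hΩ'0 : Ω' ≠ 0) (hΩ' : As.dualMap Ω' = p.θs 0 • Ω') {Ω : V} (hΩ : As Ω = p.θs 0 • Ω)
    {α : ℂ} {m : ℤ} (hα : (p.q ^ 2 - p.q ^ (-2 : ℤ)) * p.χ⁻¹ * α * p.cs * p.q ^ m = 1) {N : ℕ}
    (hN : N ≤ p.n) (v : Fin N → ℂ) :
    racahVec p A.dualMap Ω' (p.q ^ (2 * N)) (betheKet p A As 1 α m Ω v)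
      = (p.normStar v)⁻¹ * Ω' Ω := by
  rw [betheKet, stringB_eq hp, LinearMap.smul_apply, map_smul, h.racahVec_aeval_apply hp hΩ'0 hΩ' hΩ
    hN (p.monic_bethePoly v) (p.natDegree_bethePoly v), smul_eq_mul, ← mul_assoc,
    prod_dynScalar_mul_prod hp hα]

/-- The on-shell bra is an eigencovector of `A*` for `θ*_N`, hence proportional to the normalized one. -/
theorem IsAWPair.exists_betheBra_eq_smul_racahVec (hp : p.Valid) (h : IsAWPair p A As)
    {Ω' : Dual ℂ V} (hΩ'0 : Ω' ≠ 0) (hΩ' : As.dualMap Ω' = p.θs 0 • Ω') {β : ℂ} (hβ : β ≠ 0)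
    {m : ℤ} {N : ℕ} (hN : N ≤ p.n) {v : Fin N → ℂ} (hv : p.IsBetheSolution 1 v) :
    ∃ l : ℂ, l ≠ 0 ∧
      betheBra p A As 1 β m Ω' v = l • racahVec p A.dualMap Ω' (p.q ^ (2 * N)) := by
  have hd := h.dual hp
  have hX := (hd.swap hp).isXPair hp.swap
  rw [← dualMap_shiftedComm hp] at hX
  obtain ⟨s, hs, hbra⟩ := exists_betheBra_eq (A := A) (As := As) (m := m) hp one_ne_zero (β := β)
    (fun k => by rw [gammaFn_one_zero]; exact mul_ne_zero hβ (zpow_ne_zero _ hp.q_ne)) hv Ω'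
  have heig := hX.apply_bethePoly hp.swap hΩ' (hv.swap hp)
  have hne := hX.aeval_apply_ne_zero hd.finrank_eq hΩ'0 hΩ' (p.monic_bethePoly v)
    ((p.natDegree_bethePoly v).trans_le hN)
  rw [hp.bethePoly_swap] at heig
  obtain ⟨a, ha⟩ := exists_eq_smul_of_eigenvector hd.finrank_eq h.θs_inj
    (x := fun k => racahVec p A.dualMap Ω' (p.q ^ (2 * k)))
    (fun k _ => hd.racahVec_ne_zero hp hΩ'0 hΩ' _)
    (fun k hk => hd.apply_racahVec hp hΩ'0 hΩ' hk) hN heig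
  refine ⟨s * a, mul_ne_zero hs ?_, ?_⟩
  · rintro rfl
    rw [zero_smul] at ha
    exact hne ha
  · rw [hbra, ha, smul_smul]

end

end BetheRacah

end

theorem mainTheorem1 {V : Type*} [AddCommGroup V] [Module ℂ V]
    (p : BetheRacah.Params) (hp : p.Valid)
    (A As : Module.End ℂ V) (hA : BetheRacah.IsAWPair p A As)
    -- the reference states `|Ω⁻⟩ = |θ_0⟩`, `|Ω⁺⟩ = |θ*_0⟩` and `⟨Ω⁺| = ⟨θ*_0|`
    (Ωm Ωp : V) (Ωp' : Module.Dual ℂ V)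
    (hΩm : Ωm ≠ 0) (hΩm_eig : A Ωm = p.θ 0 • Ωm)
    (hΩp : Ωp ≠ 0) (hΩp_eig : As Ωp = p.θs 0 • Ωp)
    (hΩp' : Ωp' ≠ 0) (hΩp'_eig : Ωp' ∘ₗ As = p.θs 0 • Ωp')
    -- the gauge parameters of `|Ψ_-^M⟩`, `|Ψ_+^N⟩` and `⟨Ψ_+^N|`
    (m₀ : ℤ) (αm αp βp : ℂ)
    (hαm : (p.q ^ 2 - p.q ^ (-2 : ℤ)) * p.χ⁻¹ * αm * p.b * p.q ^ (-m₀) = -1)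
    (hαp : (p.q ^ 2 - p.q ^ (-2 : ℤ)) * p.χ⁻¹ * αp * p.cs * p.q ^ m₀ = 1)
    (hβp : (p.q ^ 2 - p.q ^ (-2 : ℤ)) * p.χ⁻¹ * βp * p.bs * p.q ^ (-m₀ + 2) = 1)
    (M N : ℕ) (hM : M ≤ p.n) (hN : N ≤ p.n)
    (u : Fin M → ℂ) (hu : p.IsBetheSolution (-1) u)
    (v : Fin N → ℂ) (hv : p.IsBetheSolution 1 v) :
    -- the denominators of the `₄φ₃` and of the right-hand side do not vanish
    (∀ k ≤ p.n,
      BetheRacah.qPoch (-(p.b / p.cs) * p.q ^ (p.n + 1) * p.ζ ^ 2) (p.q ^ 2) k ≠ 0 ∧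
      BetheRacah.qPoch (-(p.bs / p.c) * p.q ^ (p.n + 1) * p.ζ ^ (-2 : ℤ)) (p.q ^ 2) k ≠ 0 ∧
      BetheRacah.qPoch (p.q ^ (-2 * (p.n : ℤ))) (p.q ^ 2) k ≠ 0) ∧
    p.normStar v ≠ 0 ∧
    Ωp' (BetheRacah.betheKet p A As (-1) αm m₀ Ωm u) ≠ 0 ∧
    BetheRacah.betheBra p A As 1 βp m₀ Ωp' v (BetheRacah.betheKet p A As 1 αp m₀ Ωp v) ≠ 0 ∧
    p.qRacah M N =
      (p.normStar v)⁻¹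
        * (BetheRacah.betheBra p A As 1 βp m₀ Ωp' v (BetheRacah.betheKet p A As (-1) αm m₀ Ωm u)
            / Ωp' (BetheRacah.betheKet p A As (-1) αm m₀ Ωm u))
        * (Ωp' Ωp
            / BetheRacah.betheBra p A As 1 βp m₀ Ωp' v
                (BetheRacah.betheKet p A As 1 αp m₀ Ωp v)) := by
  have hq := hp.q_ne
  have hΩ' : As.dualMap Ωp' = p.θs 0 • Ωp' := hΩp'_eig
  have hαm0 : αm ≠ 0 := by rintro rfl; simp at hαm
  have hαp0 : αp ≠ 0 := by rintro rfl; simp at hαp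
  have hβp0 : βp ≠ 0 := by rintro rfl; simp at hβp
  have hφ : ∀ j < p.n, p.splitCoeff (p.q ^ (2 * j)) ≠ 0 := fun j hj =>
    (hA.dual hp).splitCoeff_ne_zero hp hΩp' hΩ' hj
  have hX := hA.isXPair hp
  have hXs := hA.isXPair_swap hp
  -- the ket `|Ψ_-^M⟩` is a nonzero eigenvector of `A` for `θ_M`
  obtain ⟨s, hs, hket⟩ := BetheRacah.exists_betheKet_eq (A := A) (As := As) (m := m₀) (α := αm) hp
    (neg_ne_zero.2 one_ne_zero) (fun k => by
      rw [BetheRacah.gammaFn_neg_one]; exact mul_ne_zero hαm0 (zpow_ne_zero _ hq)) hu Ωm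
  have hket0 : BetheRacah.betheKet p A As (-1) αm m₀ Ωm u ≠ 0 := by
    rw [hket]
    exact smul_ne_zero hs (hX.aeval_apply_ne_zero hA.finrank_eq hΩm hΩm_eig (p.monic_bethePoly u)
      ((p.natDegree_bethePoly u).trans_le hM))
  have hketA : A (BetheRacah.betheKet p A As (-1) αm m₀ Ωm u)
      = p.θ M • BetheRacah.betheKet p A As (-1) αm m₀ Ωm u := by
    rw [hket, map_smul, hX.apply_bethePoly hp hΩm_eig hu, smul_comm]
  -- the ket `|Ψ_+^N⟩` is a nonzero eigenvector of `A*` for `θ*_N`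
  obtain ⟨t, ht, hketp⟩ := BetheRacah.exists_betheKet_eq (A := A) (As := As) (m := m₀) (α := αp) hp
    one_ne_zero (fun k => by
      rw [BetheRacah.gammaFn_one]
      exact neg_ne_zero.2 (mul_ne_zero hαp0 (zpow_ne_zero _ hq))) hv Ωp
  have hketp0 : BetheRacah.betheKet p A As 1 αp m₀ Ωp v ≠ 0 := by
    rw [hketp]
    exact smul_ne_zero ht (hXs.aeval_apply_ne_zero hA.finrank_eq hΩp hΩp_eig (p.monic_bethePoly v)
      ((p.natDegree_bethePoly v).trans_le hN))
  have hketpA : As (BetheRacah.betheKet p A As 1 αp m₀ Ωp v)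
      = p.θs N • BetheRacah.betheKet p A As 1 αp m₀ Ωp v := by
    have h := hXs.apply_bethePoly hp.swap hΩp_eig (hv.swap hp)
    rw [hp.bethePoly_swap] at h
    rw [hketp, map_smul, h, smul_comm]
    rfl
  -- the bra is proportional to the normalized eigencovector of `A*` for `θ*_N`
  obtain ⟨l, hl, hbra⟩ := hA.exists_betheBra_eq_smul_racahVec hp hΩp' hΩ' hβp0 (m := m₀) hN hv
  have hnorm := hA.racahVec_betheKet hp hΩp' hΩ' hΩp_eig hαp hN v
  have hnorm0 := hA.racahVec_apply_ne_zero hp hΩp' hΩ' hN hketp0 hketpA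
  have hov0 := hA.apply_ne_zero_of_eigenvector hp hΩp' hΩ' hketA hket0
  have hov := hA.racahVec_apply hp hΩp' hΩ' hN hketA
  rw [hnorm] at hnorm0
  refine ⟨fun k hk => ⟨?_, ?_, ?_⟩, ?_, hov0, ?_, ?_⟩
  · exact BetheRacah.qPoch_ne_zero fun j hj => BetheRacah.Params.splitCoeff_factor₁ (hφ j (by omega))
  · exact BetheRacah.qPoch_ne_zero fun j hj => BetheRacah.Params.splitCoeff_factor₂ (hφ j (by omega))
  · exact BetheRacah.qPoch_ne_zero fun j hj => BetheRacah.Params.splitCoeff_factor₃ (hφ j (by omega))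
  · exact fun h => left_ne_zero_of_mul hnorm0 (by rw [h, inv_zero])
  · rw [hbra, LinearMap.smul_apply, hnorm]
    exact smul_ne_zero hl hnorm0
  · rw [hbra, LinearMap.smul_apply, LinearMap.smul_apply, hnorm, hov, smul_eq_mul, smul_eq_mul]
    have h1 := left_ne_zero_of_mul hnorm0
    have h2 := right_ne_zero_of_mul hnorm0
    generalize (p.normStar v)⁻¹ = x at *
    field_simp
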